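/- Let $d\ge 1$, $n>3$, let $\mu$ be a Borel measure on $\mathbb{R}^d$ with $\mu([0,1]^d)=1$, and let $(X_i)_{i\in\mathbb{N}}$ be a time-homogeneous Markov chain with values in $\mathbb{R}^d$ such that, for each $x$, the conditional law of $X_{i+1}$ given $X_i=x$ has a density $s(x,\cdot)$ with respect to $\mu$. Put $A=[0,1]^{2d}$ and, for non-negative $f,f'$ on $\mathbb{R}^{d}\times\mathbb{R}^d$, $$H^2(f,f')=\frac1{2n}\sum_{i=0}^{n-1}\int\Big(\sqrt{f(X_i,y)}-\sqrt{f'(X_i,y)}\Big)^2d\mu(y).$$ *Partitions.* For $j\in\mathbb{N}$ and $1\le l\le 2^j$ let $I_j(l)=[\frac{l-1}{2^j},\frac l{2^j})$ if $l<2^j$ and $I_j(2^j)=[1-2^{-j},1]$; let $\mathcal K_j$ be the set of cubes $\prod_{i=1}^{2d}I_j(l_i)$, $1\le l_i\le 2^j$. Let $\mathcal M_\infty$ be the set of all partitions of $A$ obtained from $\{A\}$ in finitely many steps, where in each step every cube $K\in\mathcal K_j$ of the current partition is either kept or divided into the $4^d$ elements of $\mathcal K_{j+1}$ contained in it. *Estimator.*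 For $m\in\mathcal M_\infty$ let (with $0/0=0$) $$\hat s_m=\sum_{K\in m}\frac{\sum_{i=0}^{n-1}\mathbf 1_K(X_i,X_{i+1})}{\sum_{i=0}^{n-1}\int_{[0,1]^d}\mathbf 1_K(X_i,y)\,d\mu(y)}\mathbf 1_K .$$ Let $\alpha=(1-1/\sqrt2)/2$ and $$T(f,f')=\frac{1}{2n\sqrt2}\sum_{i=0}^{n-1}\int\sqrt{f(X_i,y)+f'(X_i,y)}\Big(\sqrt{f'(X_i,y)}-\sqrt{f(X_i,y)}\Big)d\mu(y)+\frac1{n\sqrt2}\sum_{i=0}^{n-1}\frac{\sqrt{f'(X_i,X_{i+1})}-\sqrt{f(X_i,X_{i+1})}}{\sqrt{f(X_i,X_{i+1})+f'(X_i,X_{i+1})}}+\frac1{2n}\sum_{i=0}^{n-1}\int\big(f(X_i,y)-f'(X_i,y)\big)d\mu(y).$$ For $L>0$ let $\mathrm{pen}(m)=L|m|\log n/n$, let $m'\vee K=\{K'\cap K:\ K'\in m',\ K'\cap K\ne\emptyset\}$ and $\mathrm{pen}(m'\vee K)=L|m'\vee K|\log n/n$, and let $$\gamma(m)=\sum_{K\in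 m}\sup_{m'\in\mathcal M_\infty}\Big[\sum_{K'\in m'}\Big(\alpha H^2(\hat s_m\mathbf 1_{K\cap K'},\hat s_{m'}\mathbf 1_{K\cap K'})+T(\hat s_m\mathbf 1_{K\cap K'},\hat s_{m'}\mathbf 1_{K\cap K'})\Big)-\mathrm{pen}(m'\vee K)\Big]+2\,\mathrm{pen}(m).$$ Let $\hat m$ be any (measurable) random element of $\mathcal M_\infty$ with $\gamma(\hat m)\le\inf_{m\in\mathcal M_\infty}\gamma(m)+\frac1n$, and $\hat s(L,\infty)=\hat s_{\hat m}$. *Hölder condition.* For $\sigma\in(0,1]$ we write $f\in\mathcal H^\sigma([0,1]^{2d})$, with constant $|f|_\sigma\ge0$, if for every point of $[0,1]^{2d}$ and every coordinate, the function $f_j$ of that coordinate in $[0,1]$ obtained from $f$ by fixing the other coordinates satisfies $|f_j(a)-f_j(b)|\le|f|_\sigma|a-b|^\sigma$ for all $a,b\in[0,1]$. **Corollary.** There is a universal constant $L_0>0$ such that for every $L\ge L_0$ (in particular $L=L_0$) there is a constant $C>0$ depending only on $L$ (hence universal for $L=L_0$) such that, for all $d,n,\mu$, all chains as above, all $\sigma\in(0,1]$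 and $\sqrt s|_A\in\mathcal H^\sigma([0,1]^{2d})$, the estimator $\hat s=\hat s(L,\infty)$ satisfies $$C\,\mathbb E\big[H^2(s\mathbf 1_A,\hat s)\big]\le\big(d\,\big|\sqrt s|_A\big|_\sigma\big)^{\frac{2d}{d+\sigma}}\Big(\frac{\log n}{n}\Big)^{\frac{\sigma}{\sigma+d}}+\frac{\log n}{n}.$$ -/

import Mathlib

open MeasureTheory Set

noncomputable section

namespace TransitionDensity

/-- The state space `ℝ^d`. -/
abbrev State (d : ℕ) := Fin d → ℝ

/-- `ℝ^{2d}`, the coordinates of the first state being indexed by `Sum.inl` and those of the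
second one by `Sum.inr`; a pair of states `(x, y)` is the point `Sum.elim x y`. -/
abbrev Pt (d : ℕ) := Fin d ⊕ Fin d → ℝ

/-- `X` is a time-homogeneous Markov chain whose transition probabilities have the density
`s x ·` with respect to `μ`: for all `i` and all measurable `B`,
`P(X_{i+1} ∈ B | X_0, …, X_i) = ∫_B s(X_i, y) dμ(y)` almost surely. -/
structure IsMarkovChainWithDensity {Ω : Type*} [MeasurableSpace Ω] {d : ℕ} (P : Measure Ω)
    (μ : Measure (State d)) (s : State d → State d → ℝ) (X : ℕ → Ω → State d) : Prop where
  measurable_density : Measurable (Function.uncurry s)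
  nonneg : ∀ x y, 0 ≤ s x y
  lintegral_eq_one : ∀ x, ∫⁻ y, ENNReal.ofReal (s x y) ∂μ = 1
  measurable_chain : ∀ i, Measurable (X i)
  markov : ∀ (i : ℕ) (B : Set (State d)), MeasurableSet B →
    P[(X (i + 1) ⁻¹' B).indicator (fun _ => (1 : ℝ)) |
        ⨆ j ∈ Finset.range (i + 1), MeasurableSpace.comap (X j) inferInstance]
      =ᵐ[P] fun ω => ∫ y in B, s (X i ω) y ∂μ

/-- The class `𝓗^σ([0,1]^{2d})` with Hölder constant `R`: Hölder continuity of exponent `σ` along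
every coordinate, the other coordinates being fixed. -/
def HolderOnCube {d : ℕ} (σ R : ℝ) (f : Pt d → ℝ) : Prop :=
  ∀ z ∈ Icc (0 : Pt d) 1, ∀ j, ∀ a ∈ Icc (0 : ℝ) 1, ∀ b ∈ Icc (0 : ℝ) 1,
    |f (Function.update z j a) - f (Function.update z j b)| ≤ R * |a - b| ^ σ

/-! ### Dyadic partitions of the unit cube -/

/-- The dyadic interval `I_j(l)`, `1 ≤ l ≤ 2^j`. -/
def dyadicInterval (j l : ℕ) : Set ℝ :=
  if l < 2 ^ j then Ico (((l : ℝ) - 1) / 2 ^ j) ((l : ℝ) / 2 ^ j)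
  else Icc (((l : ℝ) - 1) / 2 ^ j) 1

/-- The collection `𝓚_j` of the dyadic cubes of side length `2^{-j}` of `[0,1]^{2d}`. -/
def dyadicCubes (d j : ℕ) : Set (Set (Pt d)) :=
  {K | ∃ l : Fin d ⊕ Fin d → ℕ, (∀ i, 1 ≤ l i ∧ l i ≤ 2 ^ j) ∧
    K = {z | ∀ i, z i ∈ dyadicInterval j (l i)}}

/-- The cubes into which a cube `K ∈ 𝓚_j` is divided: the elements of `𝓚_{j+1}` contained in
it. -/
def children {d : ℕ} (K : Set (Pt d)) : Set (Set (Pt d)) :=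
  {K' | ∃ j, K ∈ dyadicCubes d j ∧ K' ∈ dyadicCubes d (j + 1) ∧ K' ⊆ K}

/-- The partitions that can be built in at most `ℓ` steps starting from `{[0,1]^{2d}}`; at each
step, some cubes (those of `S`) are divided and the other ones are kept. -/
def partitions (d : ℕ) : ℕ → Set (Finset (Set (Pt d)))
  | 0 => {{Icc 0 1}}
  | ℓ + 1 => {m' | ∃ m ∈ partitions d ℓ, ∃ S : Set (Set (Pt d)), S ⊆ ↑m ∧
      (m' : Set (Set (Pt d))) = (↑m \ S) ∪ ⋃ K ∈ S, children K}

/-- The collection `𝓜_∞ = ⋃_{ℓ ≥ 1} 𝓜_ℓ`. -/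
def allPartitions (d : ℕ) : Set (Finset (Set (Pt d))) := ⋃ ℓ ≥ 1, partitions d ℓ

/-! ### Estimators and selection rule

In this part, `x : ℕ → State d` is a realization of the chain, of which only `x 0, …, x n` are
used. -/

/-- The indicator function of `K ⊆ ℝ^{2d}` at the pair of states `(u, v)`. -/
def ind {d : ℕ} (K : Set (Pt d)) (u v : State d) : ℝ :=
  K.indicator (fun _ => 1) (Sum.elim u v)

/-- The function `f 𝟙_K`. -/
def restr {d : ℕ} (f : State d → State d → ℝ) (K : Set (Pt d)) : State d → State d → ℝ :=
  fun u v => f u v * ind K u v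

/-- The piecewise constant estimator `ŝ_m`. -/
def pieceEst {d : ℕ} (μ : Measure (State d)) (n : ℕ) (x : ℕ → State d)
    (m : Finset (Set (Pt d))) : State d → State d → ℝ := fun u v =>
  ∑ K ∈ m, (∑ i ∈ Finset.range n, ind K (x i) (x (i + 1))) /
    (∑ i ∈ Finset.range n, ∫ y in Icc (0 : State d) 1, ind K (x i) y ∂μ) * ind K u v

/-- The squared random Hellinger-type distance `H²(f, g)`. -/
def hellSq {d : ℕ} (μ : Measure (State d)) (n : ℕ) (x : ℕ → State d)
    (f g : State d → State d → ℝ) : ℝ :=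
  1 / (2 * n) * ∑ i ∈ Finset.range n, ∫ y, (√(f (x i) y) - √(g (x i) y)) ^ 2 ∂μ

/-- The test functional `T(f, g)`. -/
def testT {d : ℕ} (μ : Measure (State d)) (n : ℕ) (x : ℕ → State d)
    (f g : State d → State d → ℝ) : ℝ :=
  1 / (2 * n * √2) * ∑ i ∈ Finset.range n,
      ∫ y, √(f (x i) y + g (x i) y) * (√(g (x i) y) - √(f (x i) y)) ∂μ
  + 1 / (n * √2) * ∑ i ∈ Finset.range n,
      (√(g (x i) (x (i + 1))) - √(f (x i) (x (i + 1)))) /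
        √(f (x i) (x (i + 1)) + g (x i) (x (i + 1)))
  + 1 / (2 * n) * ∑ i ∈ Finset.range n, ∫ y, (f (x i) y - g (x i) y) ∂μ

/-- `α = (1 - 1/√2)/2`. -/
def alpha : ℝ := (1 - 1 / √2) / 2

/-- The penalty of a finite family of sets. -/
def pen {d : ℕ} (L : ℝ) (n : ℕ) (m : Finset (Set (Pt d))) : ℝ :=
  L * (m.card * Real.log n / n)

open Classical in
/-- The partition `m' ∨ K` of the cube `K`. -/
def vee {d : ℕ} (m' : Finset (Set (Pt d))) (K : Set (Pt d)) : Finset (Set (Pt d)) :=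
  (m'.filter fun K' => (K ∩ K').Nonempty).image fun K' => K' ∩ K

/-- The criterion `γ(m)` associated with a collection `𝓜` of partitions. -/
def crit {d : ℕ} (μ : Measure (State d)) (n : ℕ) (L : ℝ) (𝓜 : Set (Finset (Set (Pt d))))
    (x : ℕ → State d) (m : Finset (Set (Pt d))) : ℝ :=
  (∑ K ∈ m, ⨆ m' : 𝓜,
    ((∑ K' ∈ m'.1,
      (alpha * hellSq μ n x (restr (pieceEst μ n x m) (K ∩ K'))
          (restr (pieceEst μ n x m'.1) (K ∩ K'))
        + testT μ n x (restr (pieceEst μ n x m) (K ∩ K'))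
          (restr (pieceEst μ n x m'.1) (K ∩ K'))))
      - pen L n (vee m'.1 K)))
  + 2 * pen L n m

/-- `m` minimizes the criterion over `𝓜` up to `1/n`. -/
def IsSelected {d : ℕ} (μ : Measure (State d)) (n : ℕ) (L : ℝ) (𝓜 : Set (Finset (Set (Pt d))))
    (x : ℕ → State d) (m : Finset (Set (Pt d))) : Prop :=
  m ∈ 𝓜 ∧ ∀ m' ∈ 𝓜, crit μ n L 𝓜 x m ≤ crit μ n L 𝓜 x m' + 1 / n

end TransitionDensity

end

open MeasureTheory Set

noncomputable section

namespace TransitionDensity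

section

/-! ### Dyadic cells -/

/-! Everything is reduced to single cells. If two histograms equal `a` and `b` on a cell of mass `M`
(for `occ`, the sum of the `δ_{X_i} ⊗ μ`) containing `N` transitions, then `αH² + T` on that cell is
`cellTest a b M N / n`. With `N` replaced by its compensator, the integral `V` of `s` over the cell,
a pointwise inequality (`cellTest_pointwise`) bounds the test by `3/2` times the squared loss of
`a`, with a margin `psi² V / 50`. This margin absorbs the main part of the noise `psi (N - V)`,
leaving `800 log n` (`cellTest_le`). Summing over the cells of `m'` that meet `K`, the remainder is
at most the penalty of `m' ∨ K` once `L ≥ 800` (`compare_le`).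

Since `T` is antisymmetric, comparing `ŝ_m̂` with `ŝ_m` in both directions leaves only the distance
between them. The definition of `m̂` bounds one direction and `compare_le` the other; the penalties
of `m̂` cancel because dyadic overlays are small (`sum_card_vee_le`). This gives an oracle
inequality against every regular partition of level at most `n` (`hellSq_selected_le`). A
bias-variance bound for regular histograms (`hellSq_regular_le`), the Hölder condition and a
balanced level (`exists_level`) give the rate.

The delicate point is a deviation inequality uniform over all cubes of level at most `2n` with
constants independent of `d`: a union bound over the cubes would cost a factor exponential in `dn`.
Instead, the exponential supermartingale of each cube is weighted by the indicator of a transition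
in the cube, or by its conditional probability. These probabilities sum to at most one over a level,
so all cubes of a level together have bounded expectation, and Markov's inequality applies to a
polynomial number of levels, starting times and exponents (`exists_concentrated`,
`abs_sum_sub_sum_le`).

Level `2n` suffices: a partition with fewer than `n` cells meeting a cube of level at most `n` has
depth at most `2n` there (`level_le_add_card_vee`), and with `n` cells or more the penalty exceeds
the trivial bound `compare_le_three`. Off the good event, of probability at least `1 - 1/n`, the
loss is at most one. -/

/-- The index (starting from `0`) of the dyadic interval of level `j` that contains `t`. -/
def code (j : ℕ) (t : ℝ) : ℕ := min ⌊2 ^ j * t⌋₊ (2 ^ j - 1)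

lemma code_lt (j : ℕ) (t : ℝ) : code j t < 2 ^ j := by
  have : 0 < 2 ^ j := by positivity
  unfold code
  omega

/-- Dropping the last binary digit commutes with the truncation, as `(2 * 2 ^ j - 1) / 2 = 2 ^ j -
1`. This is what makes the cells of successive levels nested. -/
lemma code_succ_div_two (j : ℕ) (t : ℝ) : code (j + 1) t / 2 = code j t := by
  unfold code
  have h : ⌊(2 : ℝ) ^ j * t⌋₊ = ⌊(2 : ℝ) ^ (j + 1) * t⌋₊ / 2 := by
    rw [← Nat.floor_div_ofNat]
    congr 1
    simp only [pow_succ]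
    ring
  have h2 : 0 < 2 ^ j := by positivity
  rw [h, pow_succ 2 j]
  omega

lemma code_natCast_div (j l : ℕ) (hl : l < 2 ^ j) : code j ((l : ℝ) / 2 ^ j) = l := by
  unfold code
  rw [mul_div_cancel₀ _ (by positivity), Nat.floor_natCast]
  omega

lemma natCast_div_mem_Icc (j l : ℕ) (hl : l < 2 ^ j) : (l : ℝ) / 2 ^ j ∈ Icc (0 : ℝ) 1 := by
  refine ⟨by positivity, ?_⟩
  rw [div_le_one (by positivity)]
  exact_mod_cast hl.le

/-- The truncation in `code` sends `t = 1` to the last index, which matches the closed last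
interval. The shift by one comes from numbering the intervals from `1`, and membership of `[0,1]` is
needed because natural floors send negative reals to `0`. -/
lemma mem_dyadicInterval_iff {j l : ℕ} (h1 : 1 ≤ l) (h2 : l ≤ 2 ^ j) (t : ℝ) :
    t ∈ dyadicInterval j l ↔ t ∈ Icc (0 : ℝ) 1 ∧ code j t + 1 = l := by
  obtain ⟨k, rfl⟩ : ∃ k, l = k + 1 := ⟨l - 1, by omega⟩
  have hp : (0 : ℝ) < 2 ^ j := by positivity
  have hk : (0 : ℝ) ≤ (k : ℝ) / 2 ^ j := by positivity
  unfold dyadicInterval code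
  split_ifs with h
  · have hk1 : ((k + 1 : ℕ) : ℝ) / 2 ^ j ≤ 1 := by
      rw [div_le_one hp]; exact_mod_cast h2
    have key : t ∈ Ico ((((k + 1 : ℕ) : ℝ) - 1) / 2 ^ j) (((k + 1 : ℕ) : ℝ) / 2 ^ j) ↔
        0 ≤ t ∧ ⌊2 ^ j * t⌋₊ = k := by
      constructor
      · rintro ⟨ha, hb⟩
        push_cast at ha hb
        rw [add_sub_cancel_right] at ha
        have h0 : 0 ≤ t := hk.trans ha
        refine ⟨h0, (Nat.floor_eq_iff (by positivity)).2 ⟨?_, ?_⟩⟩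
        · rw [div_le_iff₀ hp] at ha; linarith
        · rw [lt_div_iff₀ hp] at hb; linarith
      · rintro ⟨h0, hf⟩
        rw [Nat.floor_eq_iff (by positivity)] at hf
        push_cast
        rw [add_sub_cancel_right]
        refine ⟨?_, ?_⟩
        · rw [div_le_iff₀ hp]; linarith [hf.1]
        · rw [lt_div_iff₀ hp]; linarith [hf.2]
    rw [key]
    constructor
    · intro hh
      have := (key.2 hh).2
      refine ⟨⟨hh.1, by linarith⟩, by omega⟩
    · rintro ⟨⟨h0, -⟩, hf⟩
      exact ⟨h0, by omega⟩
  · have hkj : k + 1 = 2 ^ j := by omega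
    have hkr : (k : ℝ) + 1 = 2 ^ j := by exact_mod_cast hkj
    push_cast
    rw [add_sub_cancel_right]
    constructor
    · rintro ⟨ha, hb⟩
      refine ⟨⟨hk.trans ha, hb⟩, ?_⟩
      rw [div_le_iff₀ hp] at ha
      have : k ≤ ⌊2 ^ j * t⌋₊ := Nat.le_floor (by linarith)
      omega
    · rintro ⟨⟨h0, hb⟩, hf⟩
      refine ⟨?_, hb⟩
      have : k ≤ ⌊2 ^ j * t⌋₊ := by omega
      have := (Nat.le_floor_iff (by positivity)).1 this
      rw [div_le_iff₀ hp]; linarith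

variable {d : ℕ}

/-- The dyadic cube of level `j` that contains `z`. -/
def cell (j : ℕ) (z : Pt d) : Set (Pt d) :=
  {w | w ∈ Icc (0 : Pt d) 1 ∧ ∀ i, code j (w i) = code j (z i)}

lemma mem_cell {j : ℕ} {z w : Pt d} :
    w ∈ cell j z ↔ w ∈ Icc (0 : Pt d) 1 ∧ ∀ i, code j (w i) = code j (z i) := Iff.rfl

lemma self_mem_cell (j : ℕ) {z : Pt d} (hz : z ∈ Icc (0 : Pt d) 1) : z ∈ cell j z :=
  ⟨hz, fun _ => rfl⟩

lemma cell_subset_Icc (j : ℕ) (z : Pt d) : cell j z ⊆ Icc 0 1 := fun _ h => h.1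

lemma cell_eq_of_mem {j : ℕ} {z w : Pt d} (h : w ∈ cell j z) : cell j w = cell j z := by
  ext v
  simp only [mem_cell, h.2]

lemma cell_succ_subset (j : ℕ) (z : Pt d) : cell (j + 1) z ⊆ cell j z := fun w h =>
  ⟨h.1, fun i => by rw [← code_succ_div_two j (w i), h.2 i, code_succ_div_two]⟩

lemma cell_anti (z : Pt d) : Antitone fun j => cell j z :=
  antitone_nat_of_succ_le fun j => cell_succ_subset j z

lemma cell_zero (z : Pt d) : cell 0 z = Icc 0 1 := by
  ext w
  simp [mem_cell, code]

/-- Every tuple of indices is realized by some point of the unit cube. -/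
lemma exists_code_eq (j : ℕ) (l : Fin d ⊕ Fin d → ℕ) (hl : ∀ i, l i < 2 ^ j) :
    ∃ z ∈ Icc (0 : Pt d) 1, ∀ i, code j (z i) = l i :=
  ⟨fun i => (l i : ℝ) / 2 ^ j, ⟨fun i => (natCast_div_mem_Icc j _ (hl i)).1,
    fun i => (natCast_div_mem_Icc j _ (hl i)).2⟩, fun i => code_natCast_div j _ (hl i)⟩

lemma dyadicCubes_eq (d j : ℕ) :
    dyadicCubes d j = {K | ∃ z ∈ Icc (0 : Pt d) 1, K = cell j z} := by
  have key : ∀ l : Fin d ⊕ Fin d → ℕ, (∀ i, 1 ≤ l i ∧ l i ≤ 2 ^ j) →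
      {z : Pt d | ∀ i, z i ∈ dyadicInterval j (l i)} =
        {w | w ∈ Icc (0 : Pt d) 1 ∧ ∀ i, code j (w i) + 1 = l i} := by
    intro l hl
    ext w
    simp only [mem_ofPred_eq, fun i => mem_dyadicInterval_iff (hl i).1 (hl i).2 (w i)]
    constructor
    · exact fun h => ⟨⟨fun i => (h i).1.1, fun i => (h i).1.2⟩, fun i => (h i).2⟩
    · exact fun h i => ⟨⟨h.1.1 i, h.1.2 i⟩, h.2 i⟩
  ext K
  constructor
  · rintro ⟨l, hl, rfl⟩
    obtain ⟨z, hz, hzl⟩ := exists_code_eq j (fun i => l i - 1) fun i => by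
      have := hl i; omega
    refine ⟨z, hz, ?_⟩
    rw [key l hl]
    ext w
    simp only [mem_ofPred_eq, mem_cell, hzl]
    refine and_congr_right fun _ => forall_congr' fun i => ?_
    have := hl i
    omega
  · rintro ⟨z, hz, rfl⟩
    have hl : ∀ i, 1 ≤ code j (z i) + 1 ∧ code j (z i) + 1 ≤ 2 ^ j := fun i => by
      have := code_lt j (z i); omega
    refine ⟨fun i => code j (z i) + 1, hl, ?_⟩
    rw [key _ hl]
    ext w
    simp [mem_cell]

lemma cell_mem_dyadicCubes (j : ℕ) {z : Pt d} (hz : z ∈ Icc (0 : Pt d) 1) :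
    cell j z ∈ dyadicCubes d j := by
  rw [dyadicCubes_eq]; exact ⟨z, hz, rfl⟩

/-- The cell contains points whose next binary digit in a fixed coordinate is `0` and others where
it is `1`; a cell of the next level cannot contain both. A coordinate exists because `d ≥ 1`. -/
lemma exists_mem_cell_diff (hd : 1 ≤ d) (j : ℕ) (z : Pt d) :
    ∃ w ∈ cell j z, w ∉ cell (j + 1) z := by
  classical
  let i₀ : Fin d ⊕ Fin d := Sum.inl ⟨0, hd⟩
  have hb : ∀ e : ℕ, e < 2 → ∃ w ∈ cell j z, code (j + 1) (w i₀) = 2 * code j (z i₀) + e := by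
    intro e he
    obtain ⟨w, hw, hwl⟩ := exists_code_eq (d := d) (j + 1) (fun i => 2 * code j (z i) + e)
      fun i => by have := code_lt j (z i); rw [pow_succ]; omega
    refine ⟨w, ⟨hw, fun i => ?_⟩, hwl i₀⟩
    rw [← code_succ_div_two, hwl]
    omega
  obtain ⟨w₀, h₀, e₀⟩ := hb 0 (by norm_num)
  obtain ⟨w₁, h₁, e₁⟩ := hb 1 (by norm_num)
  by_contra! h
  have a₀ := (h w₀ h₀).2 i₀
  have a₁ := (h w₁ h₁).2 i₀
  omega

/-- Consequently the level of a cube can be recovered from the cube as a set, which removes the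
ambiguity of the level quantified in `children`. -/
lemma cell_strictAnti (hd : 1 ≤ d) (z : Pt d) : StrictAnti fun j => cell j z := by
  refine strictAnti_nat_of_succ_lt fun j => ?_
  obtain ⟨w, hw, hw'⟩ := exists_mem_cell_diff hd j z
  exact ⟨cell_succ_subset j z, fun h => hw' (h hw)⟩

lemma children_cell (hd : 1 ≤ d) (j : ℕ) {z : Pt d} (hz : z ∈ Icc (0 : Pt d) 1) :
    children (cell j z) = {K | ∃ w ∈ cell j z, K = cell (j + 1) w} := by
  ext K
  simp only [children, dyadicCubes_eq, mem_ofPred_eq]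
  constructor
  · rintro ⟨i, ⟨v, hv, hvz⟩, ⟨w, hw, rfl⟩, hsub⟩
    have hij : cell j z = cell i z := by
      rw [hvz]
      exact (cell_eq_of_mem (hvz ▸ self_mem_cell j hz)).symm
    have : j = i := (cell_strictAnti hd z).injective hij
    subst this
    exact ⟨w, hsub (self_mem_cell _ hw), rfl⟩
  · rintro ⟨w, hw, rfl⟩
    refine ⟨j, ⟨z, hz, rfl⟩, ⟨w, hw.1, rfl⟩, ?_⟩
    rw [← cell_eq_of_mem hw]
    exact cell_succ_subset j w

/-- Two dyadic cubes that meet are nested. -/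
lemma cell_nested {i j : ℕ} {z w v : Pt d} (h1 : v ∈ cell i z) (h2 : v ∈ cell j w) :
    cell i z ⊆ cell j w ∧ j ≤ i ∨ cell j w ⊆ cell i z ∧ i ≤ j := by
  rw [← cell_eq_of_mem h1, ← cell_eq_of_mem h2]
  rcases le_total i j with h | h
  · exact Or.inr ⟨cell_anti v h, h⟩
  · exact Or.inl ⟨cell_anti v h, h⟩

/-- A finite partition of the unit cube into dyadic cubes. -/
structure IsDyadicPartition (m : Finset (Set (Pt d))) : Prop where
  exists_cell : ∀ K ∈ m, ∃ j, ∃ z ∈ Icc (0 : Pt d) 1, K = cell j z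
  exists_mem : ∀ z ∈ Icc (0 : Pt d) 1, ∃ K ∈ m, z ∈ K
  eq_of_mem : ∀ K ∈ m, ∀ K' ∈ m, ∀ z ∈ K, z ∈ K' → K = K'

lemma isDyadicPartition_of_mem_partitions (hd : 1 ≤ d) (ℓ : ℕ) :
    ∀ m ∈ partitions d ℓ, IsDyadicPartition m := by
  induction ℓ with
  | zero =>
    intro m hm
    simp only [partitions, mem_singleton_iff] at hm
    subst hm
    refine ⟨fun K hK => ⟨0, 0, by simp, ?_⟩, fun z hz => ⟨_, by simp, hz⟩, ?_⟩
    · rw [cell_zero]; simpa using hK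
    · intro K hK K' hK' _ _ _
      simp only [Finset.mem_singleton] at hK hK'
      rw [hK, hK']
  | succ ℓ ih =>
    rintro m' ⟨m, hm, S, hS, hm'⟩
    have hp := ih m hm
    have hmem : ∀ K', K' ∈ m' ↔ (K' ∈ m ∧ K' ∉ S) ∨ ∃ K ∈ S, K' ∈ children K := by
      intro K'
      rw [← Finset.mem_coe, hm']
      simp
    have hparent : ∀ K' ∈ m', ∃ K ∈ m, K' ⊆ K ∧
        (K' = K ∧ K ∉ S ∨ K ∈ S ∧ ∃ j, ∃ w ∈ Icc (0 : Pt d) 1, ∃ z ∈ Icc (0 : Pt d) 1,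
          K = cell j z ∧ K' = cell (j + 1) w) := by
      intro K' hK'
      rcases (hmem K').1 hK' with h | ⟨K, hK, hc⟩
      · exact ⟨K', h.1, subset_rfl, Or.inl ⟨rfl, h.2⟩⟩
      · obtain ⟨j, z, hz, rfl⟩ := hp.exists_cell K (hS hK)
        rw [children_cell hd j hz] at hc
        obtain ⟨w, hw, rfl⟩ := hc
        refine ⟨_, hS hK, ?_, Or.inr ⟨hK, j, w, hw.1, z, hz, rfl, rfl⟩⟩
        rw [← cell_eq_of_mem hw]
        exact cell_succ_subset j w
    refine ⟨fun K' hK' => ?_, fun z hz => ?_, fun K₁ h₁ K₂ h₂ v hv₁ hv₂ => ?_⟩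
    · obtain ⟨K, hK, -, ⟨rfl, -⟩ | ⟨-, j, w, hw, -, -, -, rfl⟩⟩ := hparent K' hK'
      · exact hp.exists_cell _ hK
      · exact ⟨j + 1, w, hw, rfl⟩
    · obtain ⟨K, hK, hzK⟩ := hp.exists_mem z hz
      by_cases hKS : K ∈ S
      · obtain ⟨j, w, hw, rfl⟩ := hp.exists_cell K hK
        refine ⟨cell (j + 1) z, (hmem _).2 (Or.inr ⟨_, hKS, ?_⟩), self_mem_cell _ hz⟩
        rw [children_cell hd j hw]
        exact ⟨z, hzK, rfl⟩
      · exact ⟨K, (hmem _).2 (Or.inl ⟨hK, hKS⟩), hzK⟩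
    · obtain ⟨L₁, hL₁, hs₁, c₁⟩ := hparent K₁ h₁
      obtain ⟨L₂, hL₂, hs₂, c₂⟩ := hparent K₂ h₂
      obtain rfl := hp.eq_of_mem _ hL₁ _ hL₂ v (hs₁ hv₁) (hs₂ hv₂)
      rcases c₁ with ⟨rfl, hn⟩ | ⟨hi, j, w, hw, z, hz, hL, rfl⟩ <;>
      rcases c₂ with ⟨rfl, hn'⟩ | ⟨hi', j', w', hw', z', hz', hL', rfl⟩
      · rfl
      · exact absurd hi' hn
      · exact absurd hi hn'
      · have hvj : v ∈ cell j z := hL ▸ hs₁ hv₁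
        have hvj' : v ∈ cell j' z' := hL' ▸ hs₂ hv₂
        have : cell j v = cell j' v := by
          rw [cell_eq_of_mem hvj, cell_eq_of_mem hvj', ← hL, ← hL']
        obtain rfl : j = j' := (cell_strictAnti hd v).injective this
        rw [← cell_eq_of_mem hv₁, cell_eq_of_mem hv₂]

lemma isDyadicPartition_of_mem (hd : 1 ≤ d) {m : Finset (Set (Pt d))} (hm : m ∈ allPartitions d) :
    IsDyadicPartition m := by
  simp only [allPartitions, mem_iUnion] at hm
  obtain ⟨ℓ, -, h⟩ := hm
  exact isDyadicPartition_of_mem_partitions hd ℓ m h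

lemma finite_dyadicCubes (d j : ℕ) : (dyadicCubes d j).Finite := by
  have : dyadicCubes d j ⊆ Set.range fun l : Fin d ⊕ Fin d → Fin (2 ^ j) =>
      {w : Pt d | w ∈ Icc (0 : Pt d) 1 ∧ ∀ i, code j (w i) = l i} := by
    rw [dyadicCubes_eq]
    rintro K ⟨z, hz, rfl⟩
    exact ⟨fun i => ⟨code j (z i), code_lt _ _⟩, rfl⟩
  exact (Set.finite_range _).subset this

/-- The regular partition of the unit cube into the cubes of level `j`. -/
def regular (d j : ℕ) : Finset (Set (Pt d)) := (finite_dyadicCubes d j).toFinset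

lemma mem_regular {j : ℕ} {K : Set (Pt d)} :
    K ∈ regular d j ↔ ∃ z ∈ Icc (0 : Pt d) 1, K = cell j z := by
  rw [regular, Set.Finite.mem_toFinset, dyadicCubes_eq]; rfl

lemma card_regular_le (d j : ℕ) : (regular d j).card ≤ 4 ^ (d * j) := by
  classical
  have : regular d j ⊆ Finset.univ.image fun l : Fin d ⊕ Fin d → Fin (2 ^ j) =>
      {w : Pt d | w ∈ Icc (0 : Pt d) 1 ∧ ∀ i, code j (w i) = l i} := by
    intro K hK
    obtain ⟨z, hz, rfl⟩ := mem_regular.1 hK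
    exact Finset.mem_image.2 ⟨fun i => ⟨code j (z i), code_lt _ _⟩, Finset.mem_univ _, rfl⟩
  refine (Finset.card_le_card this).trans (Finset.card_image_le.trans ?_)
  simp only [Finset.card_univ, Fintype.card_fun, Fintype.card_fin, Fintype.card_sum]
  apply le_of_eq
  rw [show (4 : ℕ) = 2 ^ 2 from rfl, ← pow_mul, ← pow_mul]
  congr 1
  ring

lemma regular_mem_partitions (hd : 1 ≤ d) (j : ℕ) : regular d j ∈ partitions d j := by
  induction j with
  | zero =>
    simp only [partitions, mem_singleton_iff]
    ext K
    rw [mem_regular, Finset.mem_singleton]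
    simp only [cell_zero]
    exact ⟨fun ⟨_, _, h⟩ => h, fun h => ⟨0, by simp, h⟩⟩
  | succ j ih =>
    refine ⟨regular d j, ih, regular d j, subset_rfl, ?_⟩
    ext K
    simp only [Finset.mem_coe, mem_regular, sdiff_self, empty_union, mem_iUnion]
    constructor
    · rintro ⟨z, hz, rfl⟩
      refine ⟨cell j z, ⟨z, hz, rfl⟩, ?_⟩
      rw [children_cell hd j hz]
      exact ⟨z, self_mem_cell j hz, rfl⟩
    · rintro ⟨K', ⟨z, hz, rfl⟩, h⟩
      rw [children_cell hd j hz] at h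
      obtain ⟨w, hw, rfl⟩ := h
      exact ⟨w, hw.1, rfl⟩

lemma partitions_subset_succ (ℓ : ℕ) : partitions d ℓ ⊆ partitions d (ℓ + 1) := fun m hm =>
  ⟨m, hm, ∅, by simp, by simp⟩

lemma regular_mem_allPartitions (hd : 1 ≤ d) (j : ℕ) : regular d j ∈ allPartitions d := by
  simp only [allPartitions, mem_iUnion]
  -- `allPartitions` asks for at least one step, so level `0` is reached by one step that divides
  -- nothing.
  exact ⟨j + 1, by omega, partitions_subset_succ j (regular_mem_partitions hd j)⟩

/-- Partitions are finite subsets of a countable family of cubes. Countability is what makes the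
loss of a random partition measurable. -/
lemma countable_allPartitions (hd : 1 ≤ d) : (allPartitions d).Countable := by
  have hT : (⋃ j, dyadicCubes d j).Countable :=
    countable_iUnion fun j => (finite_dyadicCubes d j).countable
  have h2 := (countable_ofPred_finite_subset hT)
  refine Set.Countable.mono ?_ (h2.preimage_of_injOn (f := fun m : Finset (Set (Pt d)) =>
    (m : Set (Set (Pt d)))) Finset.coe_injective.injOn)
  intro m hm
  refine ⟨m.finite_toSet, fun K hK => ?_⟩
  obtain ⟨j, z, hz, rfl⟩ := (isDyadicPartition_of_mem hd hm).exists_cell K hK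
  exact mem_iUnion.2 ⟨j, cell_mem_dyadicCubes j hz⟩

/-! ### Common refinements -/

lemma IsDyadicPartition.subset_or_subset {m m' : Finset (Set (Pt d))} (hm : IsDyadicPartition m)
    (hm' : IsDyadicPartition m') {K K' : Set (Pt d)} (hK : K ∈ m) (hK' : K' ∈ m')
    (h : (K ∩ K').Nonempty) : K ⊆ K' ∨ K' ⊆ K := by
  obtain ⟨v, h1, h2⟩ := h
  obtain ⟨i, z, hz, rfl⟩ := hm.exists_cell K hK
  obtain ⟨j, w, hw, rfl⟩ := hm'.exists_cell K' hK'
  rcases cell_nested h1 h2 with h | h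
  exacts [Or.inl h.1, Or.inr h.1]

lemma IsDyadicPartition.nonempty_of_mem {m : Finset (Set (Pt d))} (hm : IsDyadicPartition m)
    {K : Set (Pt d)} (hK : K ∈ m) : K.Nonempty := by
  obtain ⟨j, z, hz, rfl⟩ := hm.exists_cell K hK
  exact ⟨z, self_mem_cell j hz⟩

lemma IsDyadicPartition.subset_Icc {m : Finset (Set (Pt d))} (hm : IsDyadicPartition m)
    {K : Set (Pt d)} (hK : K ∈ m) : K ⊆ Icc 0 1 := by
  obtain ⟨j, z, hz, rfl⟩ := hm.exists_cell K hK
  exact cell_subset_Icc j z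

-- Intersecting with `K` is injective on the elements that meet `K`: a common point of two traces
-- would lie in two elements of `m'`.
open Classical in
lemma card_vee {m' : Finset (Set (Pt d))} (hm' : IsDyadicPartition m') (K : Set (Pt d)) :
    (vee m' K).card = (m'.filter fun K' => (K ∩ K').Nonempty).card := by
  unfold vee
  refine Finset.card_image_of_injOn fun K₁ h₁ K₂ h₂ h => ?_
  simp only [Finset.coe_filter, mem_ofPred_eq] at h₁ h₂
  obtain ⟨v, hv⟩ := h₁.2
  have hv' : v ∈ K₂ ∩ K := by
    rw [← show K₁ ∩ K = K₂ ∩ K from h]; exact ⟨hv.2, hv.1⟩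
  exact hm'.eq_of_mem _ h₁.1 _ h₂.1 v hv.2 hv'.1

/-- Two cells that meet are nested. A pair in which `K ⊆ K'` is determined by `K`, and any other
pair by `K'`; hence a sum of the two cardinalities instead of a product. -/
lemma sum_card_vee_le {m m' : Finset (Set (Pt d))} (hm : IsDyadicPartition m)
    (hm' : IsDyadicPartition m') : ∑ K ∈ m, (vee m' K).card ≤ m.card + m'.card := by
  classical
  simp only [card_vee hm']
  rw [← Finset.card_sigma]
  let pairs := m.sigma fun K => m'.filter fun K' => (K ∩ K').Nonempty
  have hmem : ∀ p ∈ pairs, p.1 ∈ m ∧ p.2 ∈ m' ∧ (p.1 ∩ p.2).Nonempty := fun p hp => by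
    simpa [pairs] using hp
  have h1 : (pairs.filter fun p => p.1 ⊆ p.2).card ≤ m.card := by
    refine Finset.card_le_card_of_injOn (fun p => p.1)
      (fun p hp => (hmem p (Finset.mem_filter.1 hp).1).1) ?_
    rintro ⟨a, b⟩ hp ⟨a', b'⟩ hq (rfl : a = a')
    obtain ⟨hp, hps⟩ := Finset.mem_filter.1 hp
    obtain ⟨hq, hqs⟩ := Finset.mem_filter.1 hq
    obtain ⟨v, hv⟩ := hm.nonempty_of_mem (hmem _ hp).1
    have : b = b' := hm'.eq_of_mem _ (hmem _ hp).2.1 _ (hmem _ hq).2.1 v (hps hv) (hqs hv)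
    rw [this]
  have h2 : (pairs.filter fun p => ¬ p.1 ⊆ p.2).card ≤ m'.card := by
    refine Finset.card_le_card_of_injOn (fun p => p.2)
      (fun p hp => (hmem p (Finset.mem_filter.1 hp).1).2.1) ?_
    rintro ⟨a, b⟩ hp ⟨a', b'⟩ hq (rfl : b = b')
    obtain ⟨hp, hps⟩ := Finset.mem_filter.1 hp
    obtain ⟨hq, hqs⟩ := Finset.mem_filter.1 hq
    obtain ⟨v, hv⟩ := hm'.nonempty_of_mem (hmem _ hp).2.1
    have e1 := (hm.subset_or_subset hm' (hmem _ hp).1 (hmem _ hp).2.1 (hmem _ hp).2.2).resolve_left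
      hps
    have e2 := (hm.subset_or_subset hm' (hmem _ hq).1 (hmem _ hq).2.1 (hmem _ hq).2.2).resolve_left
      hqs
    have : a = a' := hm.eq_of_mem _ (hmem _ hp).1 _ (hmem _ hq).1 v (e1 hv) (e2 hv)
    rw [this]
  have := Finset.card_filter_add_card_filter_not (s := pairs) fun p => p.1 ⊆ p.2
  change pairs.card ≤ _
  omega

/-- The depth of a partition inside a cube is bounded by the number of its elements there. -/
lemma level_le_add_card_vee (hd : 1 ≤ d) {m' : Finset (Set (Pt d))} (hm' : IsDyadicPartition m')
    {i j : ℕ} {z : Pt d} (hz : z ∈ Icc (0 : Pt d) 1) (hK' : cell j z ∈ m') :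
    j ≤ i + (vee m' (cell i z)).card := by
  classical
  rw [card_vee hm']
  -- At each intermediate level `k`, pick a point of the cell around `z` that leaves it at level `k
  -- + 1`. The element of `m'` through that point cannot contain a cell around `z`, so it lies in
  -- the level-`k` cell and misses the next one. Different levels give different elements.
  have key : ∀ k ∈ Finset.Ico i j, ∃ K' ∈ m', K' ⊆ cell k z ∧ Disjoint K' (cell (k + 1) z) ∧
      K'.Nonempty := by
    intro k hk
    rw [Finset.mem_Ico] at hk
    obtain ⟨v, hv, hv'⟩ := exists_mem_cell_diff hd k z
    obtain ⟨K', hK'm, hvK⟩ := hm'.exists_mem v hv.1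
    obtain ⟨l, w, hw, rfl⟩ := hm'.exists_cell K' hK'm
    have hnot : ∀ k', k' ≤ j → v ∉ cell j z → ¬ cell k' z ⊆ cell l w := by
      intro k' hk' hvj hsub
      have := hm'.eq_of_mem _ hK' _ hK'm z (self_mem_cell j hz)
        (hsub (self_mem_cell k' hz))
      exact hvj (this ▸ hvK)
    have hvj : v ∉ cell j z := fun h => hv' (cell_anti z (by omega : k + 1 ≤ j) h)
    refine ⟨_, hK'm, ?_, ?_, ⟨v, hvK⟩⟩
    · rcases cell_nested hvK hv with h | h
      · exact h.1
      · exact absurd h.1 (hnot k (by omega) hvj)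
    · rw [Set.disjoint_left]
      intro y hy hy'
      rcases cell_nested hy hy' with h | h
      · exact hv' (h.1 hvK)
      · exact absurd h.1 (hnot (k + 1) (by omega) hvj)
  choose! κ hκ using key
  have hcard : (Finset.Ico i j).card ≤ (m'.filter fun K' => (cell i z ∩ K').Nonempty).card := by
    refine Finset.card_le_card_of_injOn κ (fun k hk => ?_) ?_
    · obtain ⟨h1, h2, -, v, hv⟩ := hκ k hk
      have hik : i ≤ k := (Finset.mem_Ico.1 hk).1
      exact Finset.mem_filter.2 ⟨h1, v, cell_anti z hik (h2 hv), hv⟩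
    · have aux : ∀ k ∈ Finset.Ico i j, ∀ k' ∈ Finset.Ico i j, k < k' → κ k ≠ κ k' := by
        intro k hk k' hk' hlt he
        obtain ⟨-, -, h3, v, hv⟩ := hκ k hk
        obtain ⟨-, h2, -, -⟩ := hκ k' hk'
        exact Set.disjoint_left.1 h3 hv (cell_anti z (by omega : k + 1 ≤ k') (h2 (he ▸ hv)))
      intro k hk k' hk' he
      by_contra hne
      rcases lt_or_gt_of_ne hne with h | h
      · exact aux k hk k' hk' h he
      · exact aux k' hk' k hk h he.symm
  rw [Nat.card_Ico] at hcard
  omega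

/-! ### Measurability -/

lemma measurable_code (j : ℕ) : Measurable (code j) := by
  unfold code
  exact (Nat.measurable_floor.comp (measurable_id.const_mul _)).min measurable_const

lemma measurableSet_cell (j : ℕ) (z : Pt d) : MeasurableSet (cell j z) := by
  have : cell j z = Icc 0 1 ∩ ⋂ i, {w : Pt d | code j (w i) = code j (z i)} := by
    ext w; simp [mem_cell]
  rw [this]
  refine measurableSet_Icc.inter (MeasurableSet.iInter fun i => ?_)
  exact ((measurable_code j).comp (measurable_pi_apply i)) (measurableSet_singleton _)

/-- The two factors of a dyadic cube. -/
lemma sumElim_mem_cell {j : ℕ} {z : Pt d} {u v : State d} :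
    Sum.elim u v ∈ cell j z ↔
      (u ∈ Icc (0 : State d) 1 ∧ ∀ i, code j (u i) = code j (z (Sum.inl i))) ∧
      (v ∈ Icc (0 : State d) 1 ∧ ∀ i, code j (v i) = code j (z (Sum.inr i))) := by
  simp only [mem_cell, mem_Icc, Pi.le_def, Sum.forall, Sum.elim_inl, Sum.elim_inr, Pi.zero_apply,
    Pi.one_apply]
  tauto

lemma measurableSet_codeBox (j : ℕ) (c : Fin d → ℕ) :
    MeasurableSet {v : State d | v ∈ Icc (0 : State d) 1 ∧ ∀ i, code j (v i) = c i} := by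
  have : {v : State d | v ∈ Icc (0 : State d) 1 ∧ ∀ i, code j (v i) = c i} =
      Icc 0 1 ∩ ⋂ i, {v : State d | code j (v i) = c i} := by
    ext w; simp
  rw [this]
  refine measurableSet_Icc.inter (MeasurableSet.iInter fun i => ?_)
  exact ((measurable_code j).comp (measurable_pi_apply i)) (measurableSet_singleton _)

end

section

/-! ### From exponential moments to deviations -/

lemma exp_sub_one_le {l : ℝ} (h0 : 0 ≤ l) (h1 : l ≤ 1) : Real.exp l - 1 ≤ l + l ^ 2 := by
  have := Real.abs_exp_sub_one_sub_id_le (x := l) (by rw [abs_of_nonneg h0]; exact h1)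
  have := (abs_le.1 this).2
  linarith

lemma le_one_sub_exp_neg {l : ℝ} (h0 : 0 ≤ l) (h1 : l ≤ 1) : l - l ^ 2 ≤ 1 - Real.exp (-l) := by
  have := Real.abs_exp_sub_one_sub_id_le (x := -l) (by rw [abs_neg, abs_of_nonneg h0]; exact h1)
  have := (abs_le.1 this).2
  nlinarith

/-- Control of a sum `∑ ξ` by its compensator `∑ ν`, and conversely, when the exponential
processes started at the first success and at the first time when `ν` is not small are bounded. -/
lemma abs_sum_sub_sum_le {n : ℕ} (hn : 3 < n) {ξ ν : ℕ → ℝ} (hξ : ∀ i, ξ i = 0 ∨ ξ i = 1)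
    (hν0 : ∀ i, 0 ≤ ν i) (hν1 : ∀ i, ν i ≤ 1)
    (hup : ∀ t < n, ∀ k < n, ξ t * Real.exp (∑ i ∈ Finset.Ico (t + 1) n,
      ((1 / (k + 1 : ℝ)) * ξ i - (Real.exp (1 / (k + 1 : ℝ)) - 1) * ν i)) ≤ (n : ℝ) ^ 6)
    (hlo : ∀ t < n, ∀ k < n, ν t * Real.exp (∑ i ∈ Finset.Ico t n,
      ((-(1 / (k + 1 : ℝ))) * ξ i - (Real.exp (-(1 / (k + 1 : ℝ))) - 1) * ν i)) ≤ (n : ℝ) ^ 6)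
    {l : ℝ} (hl0 : 0 < l) (hl1 : l ≤ 1) :
    |∑ i ∈ Finset.range n, ξ i - ∑ i ∈ Finset.range n, ν i| ≤
      l * ∑ i ∈ Finset.range n, ν i + 2 * (8 * Real.log n) / l := by
  have hn4 : (4 : ℝ) ≤ n := by exact_mod_cast hn
  have hn0 : (0 : ℝ) < n := by linarith
  have hlog : 1 ≤ Real.log n := by
    rw [Real.le_log_iff_exp_le hn0]
    linarith [Real.exp_one_lt_d9]
  have hξ0 : ∀ i, 0 ≤ ξ i := fun i => by rcases hξ i with h | h <;> rw [h]; norm_num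
  have hξ1 : ∀ i, ξ i ≤ 1 := fun i => by rcases hξ i with h | h <;> rw [h]; norm_num
  set N := ∑ i ∈ Finset.range n, ξ i with hN
  set V := ∑ i ∈ Finset.range n, ν i with hV
  have hN0 : 0 ≤ N := Finset.sum_nonneg fun i _ => hξ0 i
  have hV0 : 0 ≤ V := Finset.sum_nonneg fun i _ => hν0 i
  have hNn : N ≤ n := by
    calc N ≤ ∑ i ∈ Finset.range n, (1 : ℝ) := Finset.sum_le_sum fun i _ => hξ1 i
      _ = n := by simp
  have hVn : V ≤ n := by
    calc V ≤ ∑ i ∈ Finset.range n, (1 : ℝ) := Finset.sum_le_sum fun i _ => hν1 i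
      _ = n := by simp
  -- the two bounds at the points of the grid
  have upper : ∀ k < n, (1 / (k + 1 : ℝ)) * N ≤
      (Real.exp (1 / (k + 1 : ℝ)) - 1) * V + 8 * Real.log n := by
    intro k hk
    set a : ℝ := 1 / (k + 1 : ℝ) with ha
    have ha0 : 0 < a := by positivity
    have ha1 : a ≤ 1 := by
      rw [ha, div_le_one (by positivity)]; linarith [(Nat.cast_nonneg k : (0 : ℝ) ≤ k)]
    have hea : 0 ≤ Real.exp a - 1 := by linarith [Real.add_one_le_exp a]
    -- Starting just after the first success `t` makes the weight `ξ t` equal to `1` and omits one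
    -- unit of `N`. The cost is `6 log n + a ≤ 8 log n`; without any success the bound is trivial.
    by_cases hex : ∃ t, t < n ∧ ξ t = 1
    · classical
      have ht := Nat.find_spec hex
      set t := Nat.find hex with htdef
      have hbefore : ∀ i < t, ξ i = 0 := by
        intro i hi
        have := Nat.find_min hex hi
        rcases hξ i with h | h
        · exact h
        · exact absurd ⟨by omega, h⟩ this
      have hNs : N = 1 + ∑ i ∈ Finset.Ico (t + 1) n, ξ i := by
        rw [hN, Finset.range_eq_Ico, ← Finset.sum_Ico_consecutive _ (Nat.zero_le (t + 1)) ht.1,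
          Finset.sum_Ico_succ_top (Nat.zero_le t), ht.2,
          Finset.sum_eq_zero fun i hi => hbefore i (Finset.mem_Ico.1 hi).2, zero_add]
      have hVs : ∑ i ∈ Finset.Ico (t + 1) n, ν i ≤ V := by
        rw [hV, Finset.range_eq_Ico]
        exact Finset.sum_le_sum_of_subset_of_nonneg
          (Finset.Ico_subset_Ico (Nat.zero_le _) le_rfl) fun i _ _ => hν0 i
      have h := hup t ht.1 k hk
      rw [ht.2, one_mul, Finset.sum_sub_distrib, ← Finset.mul_sum, ← Finset.mul_sum,
        ← Real.le_log_iff_exp_le (by positivity), Real.log_pow] at h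
      push_cast at h
      rw [hNs]
      have := mul_le_mul_of_nonneg_left hVs hea
      nlinarith
    · have hz : N = 0 := Finset.sum_eq_zero fun i hi => by
        rcases hξ i with h | h
        · exact h
        · exact absurd ⟨i, Finset.mem_range.1 hi, h⟩ hex
      rw [hz, mul_zero]
      have := mul_nonneg hea hV0
      linarith
  have lower : ∀ k < n, (1 - Real.exp (-(1 / (k + 1 : ℝ)))) * V ≤
      (1 / (k + 1 : ℝ)) * N + 8 * Real.log n := by
    intro k hk
    set a : ℝ := 1 / (k + 1 : ℝ) with ha
    have ha0 : 0 < a := by positivity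
    have hea : 0 ≤ 1 - Real.exp (-a) := by
      have : Real.exp (-a) ≤ 1 := Real.exp_le_one_iff.2 (by linarith)
      linarith
    have hea1 : 1 - Real.exp (-a) ≤ 1 := by linarith [Real.exp_pos (-a)]
    -- Starting at the first `t` with `ν t ≥ 1/n`, the weight costs one more factor `n`, hence `n ^
    -- 7`, and the terms before `t` add up to at most `1`. The total is again at most `8 log n`.
    by_cases hex : ∃ t, t < n ∧ 1 / (n : ℝ) ≤ ν t
    · classical
      have ht := Nat.find_spec hex
      set t := Nat.find hex with htdef
      have hbefore : ∑ i ∈ Finset.Ico 0 t, ν i ≤ 1 := by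
        calc ∑ i ∈ Finset.Ico 0 t, ν i ≤ ∑ i ∈ Finset.Ico 0 t, 1 / (n : ℝ) := by
              refine Finset.sum_le_sum fun i hi => ?_
              have hi := (Finset.mem_Ico.1 hi).2
              have := Nat.find_min hex hi
              push Not at this
              exact (this (by omega)).le
          _ = t / n := by simp [div_eq_mul_inv]
          _ ≤ 1 := by
              rw [div_le_one hn0]; exact_mod_cast ht.1.le
      have hVs : V = ∑ i ∈ Finset.Ico 0 t, ν i + ∑ i ∈ Finset.Ico t n, ν i := by
        rw [hV, Finset.range_eq_Ico, Finset.sum_Ico_consecutive _ (Nat.zero_le t) ht.1.le]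
      have hNs : ∑ i ∈ Finset.Ico t n, ξ i ≤ N := by
        rw [hN, Finset.range_eq_Ico]
        exact Finset.sum_le_sum_of_subset_of_nonneg
          (Finset.Ico_subset_Ico (Nat.zero_le _) le_rfl) fun i _ _ => hξ0 i
      have h := hlo t ht.1 k hk
      rw [Finset.sum_sub_distrib, ← Finset.mul_sum, ← Finset.mul_sum] at h
      have h' : Real.exp (-a * ∑ i ∈ Finset.Ico t n, ξ i -
          (Real.exp (-a) - 1) * ∑ i ∈ Finset.Ico t n, ν i) ≤ (n : ℝ) ^ 7 := by
        have e := mul_le_mul_of_nonneg_right ht.2 (Real.exp_nonneg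
          (-a * ∑ i ∈ Finset.Ico t n, ξ i - (Real.exp (-a) - 1) * ∑ i ∈ Finset.Ico t n, ν i))
        have := e.trans h
        rw [one_div, inv_mul_le_iff₀ hn0] at this
        calc _ ≤ _ := this
          _ = _ := by ring
      rw [← Real.le_log_iff_exp_le (by positivity), Real.log_pow] at h'
      push_cast at h'
      rw [hVs]
      have := mul_le_mul_of_nonneg_left hNs ha0.le
      have := mul_le_mul_of_nonneg_left hbefore hea
      nlinarith
    · push Not at hex
      have hz : V ≤ 1 := by
        calc V ≤ ∑ i ∈ Finset.range n, 1 / (n : ℝ) :=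
              Finset.sum_le_sum fun i hi => (hex i (Finset.mem_range.1 hi)).le
          _ = 1 := by simp [hn0.ne']
      have := mul_le_mul hea1 hz hV0 zero_le_one
      have := mul_nonneg ha0.le hN0
      linarith
  -- Below `1/n` the trivial bound `|N - V| ≤ n` suffices. Above, `a = 1 / ⌈1/l⌉` is a point of the
  -- grid with `l / 2 ≤ a ≤ l`.
  by_cases hln : l < 1 / n
  · have h1 : (n : ℝ) ≤ 1 / l := by
      rw [le_div_iff₀ hl0]; rw [lt_div_iff₀ hn0] at hln; linarith
    have h2 : 1 / l ≤ 2 * (8 * Real.log n) / l := by gcongr; linarith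
    have h3 : 0 ≤ l * V := by positivity
    rw [abs_le]; constructor <;> linarith
  · push Not at hln
    obtain ⟨k, hk⟩ : ∃ k, ⌈1 / l⌉₊ = k + 1 := by
      have : 0 < ⌈1 / l⌉₊ := Nat.ceil_pos.2 (by positivity)
      exact ⟨⌈1 / l⌉₊ - 1, by omega⟩
    have hkn : k < n := by
      have : ⌈1 / l⌉₊ ≤ n := by
        rw [Nat.ceil_le, div_le_iff₀ hl0]
        rw [div_le_iff₀ hn0] at hln
        linarith
      omega
    set a : ℝ := 1 / (k + 1 : ℝ) with ha
    have ha0 : 0 < a := by positivity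
    have ha1 : a ≤ 1 := by
      rw [ha, div_le_one (by positivity)]; linarith [(Nat.cast_nonneg k : (0 : ℝ) ≤ k)]
    have hk1 : 1 / l ≤ (k : ℝ) + 1 := by
      have := Nat.le_ceil (1 / l); rw [hk] at this; exact_mod_cast this
    have hk2 : (k : ℝ) + 1 ≤ 2 / l := by
      have h3 := Nat.ceil_lt_add_one (a := 1 / l) (by positivity)
      rw [hk] at h3
      push_cast at h3
      have h4 : 1 ≤ 1 / l := by rw [le_div_iff₀ hl0]; linarith
      have : 2 / l = 1 / l + 1 / l := by ring
      linarith
    have hal : a ≤ l := by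
      rw [ha, div_le_iff₀ (by positivity)]
      rw [div_le_iff₀ hl0] at hk1
      linarith
    have ha2 : 1 / a ≤ 2 / l := by rw [ha, one_div_one_div]; exact hk2
    have hU := upper k hkn
    have hL := lower k hkn
    have e1 := mul_le_mul_of_nonneg_right (exp_sub_one_le ha0.le ha1) hV0
    have e2 := mul_le_mul_of_nonneg_right (le_one_sub_exp_neg ha0.le ha1) hV0
    have key : a * |N - V| ≤ a ^ 2 * V + 8 * Real.log n := by
      rw [← abs_of_pos ha0, ← abs_mul, abs_of_pos ha0, abs_le]
      constructor <;> nlinarith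
    have key2 : |N - V| ≤ a * V + (8 * Real.log n) * (1 / a) := by
      rw [← mul_le_mul_iff_right₀ ha0]
      calc _ ≤ _ := key
        _ = _ := by field_simp
    calc |N - V| ≤ a * V + (8 * Real.log n) * (1 / a) := key2
      _ ≤ l * V + (8 * Real.log n) * (2 / l) := by gcongr
      _ = _ := by ring

end

section

variable {d : ℕ}

/-! ### Indicators and conditional probabilities of cells -/

lemma ind_eq_zero_or_one (K : Set (Pt d)) (u v : State d) : ind K u v = 0 ∨ ind K u v = 1 := by
  unfold ind
  by_cases h : Sum.elim u v ∈ K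
  · right; simp [h]
  · left; simp [h]

lemma ind_nonneg (K : Set (Pt d)) (u v : State d) : 0 ≤ ind K u v := by
  rcases ind_eq_zero_or_one K u v with h | h <;> rw [h]; norm_num

lemma ind_le_one (K : Set (Pt d)) (u v : State d) : ind K u v ≤ 1 := by
  rcases ind_eq_zero_or_one K u v with h | h <;> rw [h]; norm_num

lemma measurable_sumElim : Measurable fun p : State d × State d => (Sum.elim p.1 p.2 : Pt d) := by
  refine measurable_pi_lambda _ fun i => ?_
  rcases i with i | i
  · exact (measurable_pi_apply i).comp measurable_fst
  · exact (measurable_pi_apply i).comp measurable_snd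

lemma measurable_ind {K : Set (Pt d)} (hK : MeasurableSet K) :
    Measurable fun p : State d × State d => ind K p.1 p.2 :=
  (measurable_const.indicator hK).comp measurable_sumElim

/-- At most one element of a dyadic partition contains a given point. -/
lemma IsDyadicPartition.sum_ind_le_one {m : Finset (Set (Pt d))} (hm : IsDyadicPartition m)
    (u v : State d) : ∑ K ∈ m, ind K u v ≤ 1 := by
  by_cases h : ∃ K ∈ m, Sum.elim u v ∈ K
  · obtain ⟨K, hK, hv⟩ := h
    rw [Finset.sum_eq_single_of_mem K hK]
    · exact ind_le_one K u v
    · intro K' hK' hne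
      refine Set.indicator_of_notMem (fun hv' => hne ?_) _
      exact hm.eq_of_mem _ hK' _ hK _ hv' hv
  · push Not at h
    rw [Finset.sum_eq_zero]
    · exact zero_le_one
    · exact fun K hK => Set.indicator_of_notMem (h K hK) _

lemma isDyadicPartition_regular (hd : 1 ≤ d) (j : ℕ) : IsDyadicPartition (regular d j) :=
  isDyadicPartition_of_mem hd (regular_mem_allPartitions hd j)

/-- The conditional probability that the next transition, from the state `u`, falls in `K`. -/
def drift (μ : Measure (State d)) (s : State d → State d → ℝ) (K : Set (Pt d)) (u : State d) : ℝ :=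
  ∫ y, restr s K u y ∂μ

section Chain

variable {Ω : Type*} {μ : Measure (State d)} {s : State d → State d → ℝ} {X : ℕ → Ω → State d}

/-- The σ-algebra generated by `X 0, …, X i`. -/
@[reducible]
def past (X : ℕ → Ω → State d) (i : ℕ) : MeasurableSpace Ω :=
  ⨆ j ∈ Finset.range (i + 1), MeasurableSpace.comap (X j) inferInstance

lemma past_mono {i j : ℕ} (h : i ≤ j) : past X i ≤ past X j := by
  unfold past
  refine iSup₂_le fun k hk => ?_
  exact le_iSup₂_of_le k (Finset.mem_range.2 (by have := Finset.mem_range.1 hk; omega)) le_rfl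

lemma measurable_past {i j : ℕ} (h : j ≤ i) : Measurable[past X i] (X j) := by
  refine (comap_measurable (X j)).mono ?_ le_rfl
  exact le_iSup₂_of_le (f := fun j (_ : j ∈ Finset.range (i + 1)) =>
    MeasurableSpace.comap (X j) inferInstance) j (Finset.mem_range.2 (by omega)) le_rfl

/-- The exponential process of a cell, between the times `a` and `b`. -/
def expProc (μ : Measure (State d)) (s : State d → State d → ℝ) (X : ℕ → Ω → State d) (l : ℝ)
    (K : Set (Pt d)) (a b : ℕ) (ω : Ω) : ℝ :=
  Real.exp (∑ i ∈ Finset.Ico a b,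
    (l * ind K (X i ω) (X (i + 1) ω) - (Real.exp l - 1) * drift μ s K (X i ω)))

lemma expProc_pos (l : ℝ) (K : Set (Pt d)) (a b : ℕ) (ω : Ω) : 0 < expProc μ s X l K a b ω :=
  Real.exp_pos _

lemma expProc_succ (l : ℝ) (K : Set (Pt d)) {a b : ℕ} (h : a ≤ b) (ω : Ω) :
    expProc μ s X l K a (b + 1) ω = expProc μ s X l K a b ω *
      Real.exp (l * ind K (X b ω) (X (b + 1) ω) - (Real.exp l - 1) * drift μ s K (X b ω)) := by
  rw [expProc, Finset.sum_Ico_succ_top h, Real.exp_add, expProc]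

lemma exp_mul_ind (l : ℝ) (K : Set (Pt d)) (u v : State d) :
    Real.exp (l * ind K u v) = 1 + (Real.exp l - 1) * ind K u v := by
  rcases ind_eq_zero_or_one K u v with h | h <;> simp [h]

variable [MeasurableSpace Ω] {P : Measure Ω}

namespace IsMarkovChainWithDensity

variable (hX : IsMarkovChainWithDensity P μ s X)
include hX

lemma past_le (i : ℕ) : past X i ≤ ‹MeasurableSpace Ω› :=
  iSup₂_le fun j _ => (hX.measurable_chain j).comap_le

lemma measurable_density_right (u : State d) : Measurable (s u) :=
  hX.measurable_density.comp (measurable_const.prodMk measurable_id)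

lemma integrable_density (u : State d) : Integrable (s u) μ := by
  refine ⟨(hX.measurable_density_right u).aestronglyMeasurable, ?_⟩
  rw [hasFiniteIntegral_iff_ofReal (Filter.Eventually.of_forall (hX.nonneg u)),
    hX.lintegral_eq_one u]
  exact ENNReal.one_lt_top

lemma integral_density (u : State d) : ∫ y, s u y ∂μ = 1 := by
  rw [integral_eq_lintegral_of_nonneg_ae (Filter.Eventually.of_forall (hX.nonneg u))
    (hX.measurable_density_right u).aestronglyMeasurable, hX.lintegral_eq_one u]
  simp

lemma restr_nonneg (K : Set (Pt d)) (u v : State d) : 0 ≤ restr s K u v :=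
  mul_nonneg (hX.nonneg u v) (ind_nonneg K u v)

lemma integrable_restr {K : Set (Pt d)} (hK : MeasurableSet K) (u : State d) :
    Integrable (restr s K u) μ := by
  refine (hX.integrable_density u).mono' ?_ (Filter.Eventually.of_forall fun v => ?_)
  · exact ((hX.measurable_density_right u).mul
      ((measurable_ind hK).comp (measurable_const.prodMk measurable_id))).aestronglyMeasurable
  · rw [Real.norm_of_nonneg (hX.restr_nonneg K u v)]
    exact mul_le_of_le_one_right (hX.nonneg u v) (ind_le_one K u v)

lemma drift_nonneg (K : Set (Pt d)) (u : State d) : 0 ≤ drift μ s K u :=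
  integral_nonneg fun v => hX.restr_nonneg K u v

lemma drift_le_one {K : Set (Pt d)} (hK : MeasurableSet K) (u : State d) : drift μ s K u ≤ 1 := by
  rw [← hX.integral_density u]
  exact integral_mono (hX.integrable_restr hK u) (hX.integrable_density u) fun v =>
    mul_le_of_le_one_right (hX.nonneg u v) (ind_le_one K u v)

lemma sum_drift_regular_le_one (hd : 1 ≤ d) (j : ℕ) (u : State d) :
    ∑ K ∈ regular d j, drift μ s K u ≤ 1 := by
  have hmeas : ∀ K ∈ regular d j, MeasurableSet K := fun K hK => by
    obtain ⟨z, -, rfl⟩ := mem_regular.1 hK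
    exact measurableSet_cell j z
  unfold drift
  rw [← integral_finsetSum _ fun K hK => hX.integrable_restr (hmeas K hK) u,
    ← hX.integral_density u]
  refine integral_mono (integrable_finsetSum _ fun K hK => hX.integrable_restr (hmeas K hK) u)
    (hX.integrable_density u) fun v => ?_
  simp only [restr]
  rw [← Finset.mul_sum]
  exact mul_le_of_le_one_right (hX.nonneg u v)
    ((isDyadicPartition_regular hd j).sum_ind_le_one u v)

/-- Measurability of an integral in its parameter is obtained through a finite measure: `μ` is only
controlled on the unit cube, and the integrand vanishes outside it. -/
lemma measurable_drift (hμ : μ (Icc 0 1) = 1) {K : Set (Pt d)} (hK : MeasurableSet K)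
    (hKA : K ⊆ Icc 0 1) : Measurable (drift μ s K) := by
  have hfin : IsFiniteMeasure (μ.restrict (Icc 0 1)) := ⟨by simp [hμ]⟩
  have : drift μ s K = fun u => ∫ y in Icc (0 : State d) 1, restr s K u y ∂μ := by
    funext u
    refine (setIntegral_eq_integral_of_forall_compl_eq_zero fun v hv => ?_).symm
    have : Sum.elim u v ∉ K := fun h => hv ⟨fun i => (hKA h).1 (Sum.inr i),
      fun i => (hKA h).2 (Sum.inr i)⟩
    simp [restr, ind, this]
  rw [this]
  have hm : Measurable (Function.uncurry fun u v => restr s K u v) :=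
    hX.measurable_density.mul (measurable_ind hK)
  exact (hm.stronglyMeasurable.integral_prod_right (ν := μ.restrict (Icc 0 1))).measurable

/-- The indicator of a transition in a dyadic cube may be replaced by its conditional
expectation. -/
lemma integral_mul_ind [IsProbabilityMeasure P] {j : ℕ} (z : Pt d)
    {i : ℕ} {G : Ω → ℝ} (hG : Measurable[past X i] G) {B : ℝ} (hB : ∀ ω, |G ω| ≤ B) :
    ∫ ω, G ω * ind (cell j z) (X i ω) (X (i + 1) ω) ∂P =
      ∫ ω, G ω * drift μ s (cell j z) (X i ω) ∂P := by
  classical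
  set Q : Set (State d) := {u | u ∈ Icc (0 : State d) 1 ∧ ∀ i, code j (u i) = code j (z (Sum.inl i))}
    with hQ
  set Q' : Set (State d) :=
    {v | v ∈ Icc (0 : State d) 1 ∧ ∀ i, code j (v i) = code j (z (Sum.inr i))} with hQ'
  have hQm : MeasurableSet Q := measurableSet_codeBox j _
  have hQm' : MeasurableSet Q' := measurableSet_codeBox j _
  -- A cell is a product of two boxes. The factor in `X i` joins `G` as part of the past, and the
  -- Markov property is applied to the box of `X (i + 1)`.
  have hind : ∀ u v, ind (cell j z) u v = Q.indicator (fun _ => 1) u * Q'.indicator (fun _ => 1) v := by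
    intro u v
    have : Sum.elim u v ∈ cell j z ↔ u ∈ Q ∧ v ∈ Q' := sumElim_mem_cell
    by_cases h1 : u ∈ Q <;> by_cases h2 : v ∈ Q' <;> simp [ind, this, h1, h2]
  set G' : Ω → ℝ := fun ω => G ω * Q.indicator (fun _ => 1) (X i ω) with hG'
  have hG'm : Measurable[past X i] G' :=
    hG.mul ((measurable_const.indicator hQm).comp (measurable_past le_rfl))
  have hG'b : ∀ ω, ‖G' ω‖ ≤ B := fun ω => by
    rw [hG', norm_mul, Real.norm_eq_abs]
    refine (mul_le_of_le_one_right (abs_nonneg _) ?_).trans (hB ω)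
    by_cases h : X i ω ∈ Q <;> simp [h]
  set I : Ω → ℝ := (X (i + 1) ⁻¹' Q').indicator (fun _ => (1 : ℝ)) with hI
  have hIm : MeasurableSet (X (i + 1) ⁻¹' Q') := hX.measurable_chain (i + 1) hQm'
  have hIint : Integrable I P := (integrable_const 1).indicator hIm
  have hle := hX.past_le i
  have hGI : Integrable (G' * I) P :=
    hIint.bdd_mul (hG'm.mono hle le_rfl).aestronglyMeasurable (Filter.Eventually.of_forall hG'b)
  have hcond : P[G' * I | past X i] =ᵐ[P] fun ω => G ω * drift μ s (cell j z) (X i ω) := by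
    refine (condExp_mul_of_stronglyMeasurable_left hG'm.stronglyMeasurable hGI hIint).trans ?_
    filter_upwards [hX.markov i Q' hQm'] with ω hω
    rw [Pi.mul_apply]
    have hω' : (P[I | past X i]) ω = ∫ y in Q', s (X i ω) y ∂μ := hω
    rw [hω', hG', mul_assoc]
    congr 1
    simp only [drift, restr, hind]
    rw [← integral_indicator hQm', ← integral_const_mul]
    congr 1
    funext y
    by_cases h2 : y ∈ Q' <;> simp [h2, mul_comm]
  calc ∫ ω, G ω * ind (cell j z) (X i ω) (X (i + 1) ω) ∂P = ∫ ω, (G' * I) ω ∂P := by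
        congr 1
        funext ω
        rw [Pi.mul_apply, hG', hind, ← mul_assoc]
        rfl
    _ = ∫ ω, (P[G' * I | past X i]) ω ∂P := (integral_condExp hle).symm
    _ = _ := integral_congr_ae hcond

/-! ### Exponential supermartingales -/

lemma expProc_le (l : ℝ) {K : Set (Pt d)} (hK : MeasurableSet K) (a b : ℕ) (ω : Ω) :
    expProc μ s X l K a b ω ≤ Real.exp (∑ _i ∈ Finset.Ico a b, (|l| + |Real.exp l - 1|)) := by
  refine Real.exp_le_exp.2 (Finset.sum_le_sum fun i _ => ?_)
  have h1 : l * ind K (X i ω) (X (i + 1) ω) ≤ |l| := by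
    refine (le_abs_self _).trans ?_
    rw [abs_mul, abs_of_nonneg (ind_nonneg _ _ _)]
    exact mul_le_of_le_one_right (abs_nonneg _) (ind_le_one _ _ _)
  have h2 : -((Real.exp l - 1) * drift μ s K (X i ω)) ≤ |Real.exp l - 1| := by
    refine (neg_le_abs _).trans ?_
    rw [abs_mul, abs_of_nonneg (hX.drift_nonneg _ _)]
    exact mul_le_of_le_one_right (abs_nonneg _) (hX.drift_le_one hK _)
  linarith

lemma measurable_expProc (hμ : μ (Icc 0 1) = 1) (l : ℝ) {K : Set (Pt d)} (hK : MeasurableSet K)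
    (hKA : K ⊆ Icc 0 1) (a b : ℕ) : Measurable[past X b] (expProc μ s X l K a b) := by
  unfold expProc
  refine Real.measurable_exp.comp (Finset.measurable_fun_sum _ fun i hi => ?_)
  have hib := (Finset.mem_Ico.1 hi).2
  have h1 : Measurable[past X b] (X i) := measurable_past hib.le
  have h2 : Measurable[past X b] (X (i + 1)) := measurable_past hib
  exact (((measurable_ind hK).comp (h1.prodMk h2)).const_mul l).sub
    (((hX.measurable_drift hμ hK hKA).comp h1).const_mul _)

/-- Given the past, the mean of `exp (l * ind)` is `1 + (exp l - 1) * drift ≤ exp ((exp l - 1) *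
drift)`, for either sign of `l`. So the process is a supermartingale, and a weight `G` known at the
starting time can be carried along. -/
lemma integral_mul_expProc_le [IsProbabilityMeasure P] (hμ : μ (Icc 0 1) = 1) (l : ℝ) {j : ℕ}
    (z : Pt d) {a b : ℕ} (hab : a ≤ b) {G : Ω → ℝ} (hG : Measurable[past X a] G)
    (hG0 : ∀ ω, 0 ≤ G ω) (hG1 : ∀ ω, G ω ≤ 1) :
    ∫ ω, G ω * expProc μ s X l (cell j z) a b ω ∂P ≤ ∫ ω, G ω ∂P := by
  induction b, hab using Nat.le_induction with
  | base => simp [expProc]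
  | succ b hab ih =>
    refine le_trans ?_ ih
    set K := cell j z with hK
    have hKm : MeasurableSet K := measurableSet_cell j z
    set c : ℝ := Real.exp l - 1 with hc
    set B := Real.exp (∑ _i ∈ Finset.Ico a b, (|l| + |Real.exp l - 1|)) with hB
    set Y : Ω → ℝ := fun ω => G ω * expProc μ s X l K a b ω with hY
    have hY0 : ∀ ω, 0 ≤ Y ω := fun ω => mul_nonneg (hG0 ω) (expProc_pos _ _ _ _ _).le
    have hYB : ∀ ω, Y ω ≤ B := fun ω =>
      (mul_le_of_le_one_left (expProc_pos _ _ _ _ _).le (hG1 ω)).trans (hX.expProc_le l hKm a b ω)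
    have hYm : Measurable[past X b] Y :=
      (hG.mono (past_mono hab) le_rfl).mul
        (hX.measurable_expProc hμ l hKm (cell_subset_Icc j z) a b)
    have hDm : Measurable[past X b] fun ω => drift μ s K (X b ω) :=
      (hX.measurable_drift hμ hKm (cell_subset_Icc j z)).comp (measurable_past le_rfl)
    -- All the factors known at time `b`; what remains, `exp (l * ind)`, is affine in the indicator.
    set Y' : Ω → ℝ := fun ω => Y ω * Real.exp (-(c * drift μ s K (X b ω))) with hY'
    have hY'm : Measurable[past X b] Y' :=
      hYm.mul (Real.measurable_exp.comp (hDm.const_mul c).neg)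
    have hY'0 : ∀ ω, 0 ≤ Y' ω := fun ω => mul_nonneg (hY0 ω) (Real.exp_nonneg _)
    have hY'B : ∀ ω, |Y' ω| ≤ B * Real.exp |c| := fun ω => by
      rw [abs_of_nonneg (hY'0 ω)]
      refine mul_le_mul (hYB ω) (Real.exp_le_exp.2 ?_) (Real.exp_nonneg _) (Real.exp_nonneg _)
      refine (neg_le_abs _).trans ?_
      rw [abs_mul, abs_of_nonneg (hX.drift_nonneg _ _)]
      exact mul_le_of_le_one_right (abs_nonneg _) (hX.drift_le_one hKm _)
    have hle := hX.past_le b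
    have hYint : Integrable Y P :=
      Integrable.of_bound (hYm.mono hle le_rfl).aestronglyMeasurable B
        (Filter.Eventually.of_forall fun ω => by
          rw [Real.norm_of_nonneg (hY0 ω)]; exact hYB ω)
    have hY'int : Integrable Y' P :=
      Integrable.of_bound (hY'm.mono hle le_rfl).aestronglyMeasurable _
        (Filter.Eventually.of_forall hY'B)
    have hindm : Measurable fun ω => ind K (X b ω) (X (b + 1) ω) :=
      (measurable_ind hKm).comp ((hX.measurable_chain b).prodMk (hX.measurable_chain (b + 1)))
    have hY'ind : Integrable (fun ω => Y' ω * ind K (X b ω) (X (b + 1) ω)) P := by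
      refine hY'int.mul_bdd (c := 1) hindm.aestronglyMeasurable
        (Filter.Eventually.of_forall fun ω => ?_)
      rw [Real.norm_of_nonneg (ind_nonneg _ _ _)]; exact ind_le_one _ _ _
    have hY'dr : Integrable (fun ω => Y' ω * drift μ s K (X b ω)) P := by
      refine hY'int.mul_bdd (c := 1) (hDm.mono hle le_rfl).aestronglyMeasurable
        (Filter.Eventually.of_forall fun ω => ?_)
      rw [Real.norm_of_nonneg (hX.drift_nonneg _ _)]; exact hX.drift_le_one hKm _
    calc ∫ ω, G ω * expProc μ s X l K a (b + 1) ω ∂P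
        = ∫ ω, (Y' ω + c * (Y' ω * ind K (X b ω) (X (b + 1) ω))) ∂P := by
          congr 1
          funext ω
          rw [expProc_succ l K hab, sub_eq_add_neg, Real.exp_add, exp_mul_ind, hY', hY]
          ring
      _ = ∫ ω, (Y' ω + c * (Y' ω * drift μ s K (X b ω))) ∂P := by
          rw [integral_add hY'int (hY'ind.const_mul c), integral_add hY'int (hY'dr.const_mul c),
            integral_const_mul, integral_const_mul, hX.integral_mul_ind z hY'm hY'B]
      _ ≤ ∫ ω, Y ω ∂P := by
          refine integral_mono (hY'int.add (hY'dr.const_mul c)) hYint fun ω => ?_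
          have h1 := Real.add_one_le_exp (c * drift μ s K (X b ω))
          have h2 : Y' ω * Real.exp (c * drift μ s K (X b ω)) = Y ω := by
            rw [hY', mul_assoc, ← Real.exp_add, neg_add_cancel, Real.exp_zero, mul_one]
          calc Y' ω + c * (Y' ω * drift μ s K (X b ω))
              = Y' ω * (c * drift μ s K (X b ω) + 1) := by ring
            _ ≤ Y' ω * Real.exp (c * drift μ s K (X b ω)) :=
              mul_le_mul_of_nonneg_left h1 (hY'0 ω)
            _ = Y ω := h2

end IsMarkovChainWithDensity

end Chain

end

section

variable {d : ℕ} {Ω : Type*} [MeasurableSpace Ω] {P : Measure Ω}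
  {μ : Measure (State d)} {s : State d → State d → ℝ} {X : ℕ → Ω → State d}

/-! ### Uniform deviations over the dyadic cubes -/

/-- The number of the first `n` transitions that fall in `K`. -/
def hits (n : ℕ) (x : ℕ → State d) (K : Set (Pt d)) : ℝ :=
  ∑ i ∈ Finset.range n, ind K (x i) (x (i + 1))

/-- The compensator of `hits`. -/
def compensator (μ : Measure (State d)) (s : State d → State d → ℝ) (n : ℕ) (x : ℕ → State d)
    (K : Set (Pt d)) : ℝ :=
  ∑ i ∈ Finset.range n, drift μ s K (x i)

/-- On every dyadic cube of level at most `2 * n`, the number of transitions is close to its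
compensator. -/
def Concentrated (μ : Measure (State d)) (s : State d → State d → ℝ) (n : ℕ)
    (x : ℕ → State d) : Prop :=
  ∀ j ≤ 2 * n, ∀ K ∈ regular d j, ∀ l : ℝ, 0 < l → l ≤ 1 →
    |hits n x K - compensator μ s n x K| ≤
      l * compensator μ s n x K + 2 * (8 * Real.log n) / l

/-- The contribution of a cube, a starting time and a point of the grid to the sum of weighted
exponential processes. -/
def weightedProc (μ : Measure (State d)) (s : State d → State d → ℝ) (X : ℕ → Ω → State d)
    (n : ℕ) (K : Set (Pt d)) (t k : ℕ) (ω : Ω) : ℝ :=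
  ind K (X t ω) (X (t + 1) ω) * expProc μ s X (1 / (k + 1 : ℝ)) K (t + 1) n ω +
    drift μ s K (X t ω) * expProc μ s X (-(1 / (k + 1 : ℝ))) K t n ω

namespace IsMarkovChainWithDensity

variable (hX : IsMarkovChainWithDensity P μ s X)
include hX

lemma weightedProc_nonneg (n : ℕ) (K : Set (Pt d)) (t k : ℕ) (ω : Ω) :
    0 ≤ weightedProc μ s X n K t k ω :=
  add_nonneg (mul_nonneg (ind_nonneg _ _ _) (expProc_pos _ _ _ _ _).le)
    (mul_nonneg (hX.drift_nonneg _ _) (expProc_pos _ _ _ _ _).le)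

lemma integrable_mul_expProc [IsProbabilityMeasure P] (hμ : μ (Icc 0 1) = 1) (l : ℝ)
    {K : Set (Pt d)} (hK : MeasurableSet K) (hKA : K ⊆ Icc 0 1) (a b : ℕ) {G : Ω → ℝ}
    (hG : Measurable G) (hG0 : ∀ ω, 0 ≤ G ω) (hG1 : ∀ ω, G ω ≤ 1) :
    Integrable (fun ω => G ω * expProc μ s X l K a b ω) P := by
  refine Integrable.of_bound (hG.mul ((hX.measurable_expProc hμ l hK hKA a b).mono
    (hX.past_le b) le_rfl)).aestronglyMeasurable
    (Real.exp (∑ _i ∈ Finset.Ico a b, (|l| + |Real.exp l - 1|))) (Filter.Eventually.of_forall fun ω => ?_)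
  rw [Real.norm_of_nonneg (mul_nonneg (hG0 ω) (expProc_pos _ _ _ _ _).le)]
  exact (mul_le_of_le_one_left (expProc_pos _ _ _ _ _).le (hG1 ω)).trans
    (hX.expProc_le l hK a b ω)

lemma integrable_drift [IsProbabilityMeasure P] (hμ : μ (Icc 0 1) = 1) {K : Set (Pt d)}
    (hK : MeasurableSet K) (hKA : K ⊆ Icc 0 1) (t : ℕ) :
    Integrable (fun ω => drift μ s K (X t ω)) P :=
  Integrable.of_bound ((hX.measurable_drift hμ hK hKA).comp
    (hX.measurable_chain t)).aestronglyMeasurable 1 (Filter.Eventually.of_forall fun ω => by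
      rw [Real.norm_of_nonneg (hX.drift_nonneg _ _)]; exact hX.drift_le_one hK _)

lemma integrable_weightedProc [IsProbabilityMeasure P] (hμ : μ (Icc 0 1) = 1) (n : ℕ)
    {K : Set (Pt d)} (hK : MeasurableSet K) (hKA : K ⊆ Icc 0 1) (t k : ℕ) :
    Integrable (weightedProc μ s X n K t k) P := by
  refine Integrable.add (hX.integrable_mul_expProc hμ _ hK hKA _ _ ?_ (fun _ => ind_nonneg _ _ _)
    fun _ => ind_le_one _ _ _) (hX.integrable_mul_expProc hμ _ hK hKA _ _ ?_
    (fun _ => hX.drift_nonneg _ _) fun _ => hX.drift_le_one hK _)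
  · exact (measurable_ind hK).comp ((hX.measurable_chain t).prodMk (hX.measurable_chain (t + 1)))
  · exact (hX.measurable_drift hμ hK hKA).comp (hX.measurable_chain t)

/-- The first process starts at `t + 1`, when its weight is known, and the mean of that weight is
the mean drift; the second starts at `t` with the drift itself as weight. -/
lemma integral_weightedProc_le [IsProbabilityMeasure P] (hμ : μ (Icc 0 1) = 1) {n j : ℕ}
    (z : Pt d) {t : ℕ} (ht : t < n) (k : ℕ) :
    ∫ ω, weightedProc μ s X n (cell j z) t k ω ∂P ≤
      2 * ∫ ω, drift μ s (cell j z) (X t ω) ∂P := by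
  have hK := measurableSet_cell j z
  have hKA := cell_subset_Icc j z
  have h1 : Measurable[past X (t + 1)] fun ω => ind (cell j z) (X t ω) (X (t + 1) ω) :=
    (measurable_ind hK).comp ((measurable_past (Nat.le_succ t)).prodMk (measurable_past le_rfl))
  have h2 : Measurable[past X t] fun ω => drift μ s (cell j z) (X t ω) :=
    (hX.measurable_drift hμ hK hKA).comp (measurable_past le_rfl)
  unfold weightedProc
  rw [integral_add
    (hX.integrable_mul_expProc hμ _ hK hKA _ _ (h1.mono (hX.past_le _) le_rfl)
      (fun _ => ind_nonneg _ _ _) fun _ => ind_le_one _ _ _)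
    (hX.integrable_mul_expProc hμ _ hK hKA _ _ (h2.mono (hX.past_le _) le_rfl)
      (fun _ => hX.drift_nonneg _ _) fun _ => hX.drift_le_one hK _), two_mul]
  refine add_le_add ?_ ?_
  · refine (hX.integral_mul_expProc_le hμ _ z ht h1 (fun _ => ind_nonneg _ _ _)
      fun _ => ind_le_one _ _ _).trans (le_of_eq ?_)
    have := hX.integral_mul_ind (j := j) z (i := t) (G := fun _ => 1) measurable_const (B := 1)
      (by simp)
    simpa using this
  · exact hX.integral_mul_expProc_le hμ _ z ht.le h2 (fun _ => hX.drift_nonneg _ _)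
      fun _ => hX.drift_le_one hK _

/-- The deviations are controlled uniformly over the dyadic cubes, with high probability. -/
lemma exists_concentrated [IsProbabilityMeasure P] (hd : 1 ≤ d) (hμ : μ (Icc 0 1) = 1) {n : ℕ}
    (hn : 3 < n) : ∃ G : Set Ω, MeasurableSet G ∧ P.real Gᶜ ≤ 1 / n ∧
      ∀ ω ∈ G, Concentrated μ s n fun i => X i ω := by
  have hn4 : (4 : ℝ) ≤ n := by exact_mod_cast hn
  have hn0 : (0 : ℝ) < n := by linarith
  have hmeas : ∀ {j : ℕ}, ∀ K ∈ regular d j, MeasurableSet K ∧ K ⊆ Icc 0 1 := fun {j} K hK => by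
    obtain ⟨z, -, rfl⟩ := mem_regular.1 hK
    exact ⟨measurableSet_cell j z, cell_subset_Icc j z⟩
  set Φ : Ω → ℝ := fun ω => ∑ j ∈ Finset.range (2 * n + 1), ∑ t ∈ Finset.range n,
    ∑ k ∈ Finset.range n, ∑ K ∈ regular d j, weightedProc μ s X n K t k ω with hΦ
  have hw := hX.weightedProc_nonneg n
  have hK_int : ∀ {j : ℕ} (t k : ℕ), ∀ K ∈ regular d j, Integrable (weightedProc μ s X n K t k) P :=
    fun t k K hK => hX.integrable_weightedProc hμ n (hmeas K hK).1 (hmeas K hK).2 t k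
  have hint : Integrable Φ P :=
    integrable_finsetSum _ fun j _ => integrable_finsetSum _ fun t _ =>
      integrable_finsetSum _ fun k _ => integrable_finsetSum _ fun K hK => hK_int t k K hK
  have hΦ0 : ∀ ω, 0 ≤ Φ ω := fun ω => Finset.sum_nonneg fun j _ => Finset.sum_nonneg fun t _ =>
    Finset.sum_nonneg fun k _ => Finset.sum_nonneg fun K _ => hw K t k ω
  have hEΦ : ∫ ω, Φ ω ∂P ≤ (2 * n + 1) * (n * (n * 2)) := by
    rw [hΦ, integral_finsetSum _ fun j _ => integrable_finsetSum _ fun t _ =>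
      integrable_finsetSum _ fun k _ => integrable_finsetSum _ fun K hK => hK_int t k K hK]
    have hj : ∀ j ∈ Finset.range (2 * n + 1), ∫ ω, ∑ t ∈ Finset.range n,
        ∑ k ∈ Finset.range n, ∑ K ∈ regular d j, weightedProc μ s X n K t k ω ∂P ≤
          n * (n * 2 : ℝ) := by
      intro j _
      rw [integral_finsetSum _ fun t _ =>
        integrable_finsetSum _ fun k _ => integrable_finsetSum _ fun K hK => hK_int t k K hK]
      have ht : ∀ t ∈ Finset.range n, ∫ ω, ∑ k ∈ Finset.range n, ∑ K ∈ regular d j,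
          weightedProc μ s X n K t k ω ∂P ≤ (n * 2 : ℝ) := by
        intro t ht
        rw [integral_finsetSum _ fun k _ => integrable_finsetSum _ fun K hK => hK_int t k K hK]
        -- All the cubes of a level cost only `2`, since their drifts sum to at most one; neither
        -- `d` nor the number of cubes enters.
        have hk : ∀ k ∈ Finset.range n, ∫ ω, ∑ K ∈ regular d j,
            weightedProc μ s X n K t k ω ∂P ≤ (2 : ℝ) := by
          intro k _
          rw [integral_finsetSum _ fun K hK => hK_int t k K hK]
          have hdr : ∀ K ∈ regular d j, Integrable (fun ω => drift μ s K (X t ω)) P :=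
            fun K hK => hX.integrable_drift hμ (hmeas K hK).1 (hmeas K hK).2 t
          calc ∑ K ∈ regular d j, ∫ ω, weightedProc μ s X n K t k ω ∂P
              ≤ ∑ K ∈ regular d j, 2 * ∫ ω, drift μ s K (X t ω) ∂P := by
                refine Finset.sum_le_sum fun K hK => ?_
                obtain ⟨z, -, rfl⟩ := mem_regular.1 hK
                exact hX.integral_weightedProc_le hμ z (Finset.mem_range.1 ht) k
            _ = 2 * ∫ ω, ∑ K ∈ regular d j, drift μ s K (X t ω) ∂P := by
                rw [← Finset.mul_sum, integral_finsetSum _ hdr]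
            _ ≤ 2 * ∫ _ω, (1 : ℝ) ∂P := by
                refine mul_le_mul_of_nonneg_left (integral_mono (integrable_finsetSum _ hdr)
                  (integrable_const _) fun ω => ?_) zero_le_two
                exact hX.sum_drift_regular_le_one hd j _
            _ = 2 := by simp
        refine (Finset.sum_le_sum hk).trans (le_of_eq ?_)
        simp
      refine (Finset.sum_le_sum ht).trans (le_of_eq ?_)
      simp
    refine (Finset.sum_le_sum hj).trans (le_of_eq ?_)
    simp
  refine ⟨{ω | Φ ω < (n : ℝ) ^ 6}, ?_, ?_, ?_⟩
  · have hΦm : Measurable Φ := by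
      refine Finset.measurable_fun_sum _ fun j _ => Finset.measurable_fun_sum _ fun t _ =>
        Finset.measurable_fun_sum _ fun k _ => Finset.measurable_fun_sum _ fun K hK => ?_
      obtain ⟨hKm, hKA⟩ := hmeas K hK
      have he : ∀ l a, Measurable (expProc μ s X l K a n) := fun l a =>
        (hX.measurable_expProc hμ l hKm hKA a n).mono (hX.past_le n) le_rfl
      exact (((measurable_ind hKm).comp ((hX.measurable_chain t).prodMk
        (hX.measurable_chain (t + 1)))).mul (he _ _)).add
        (((hX.measurable_drift hμ hKm hKA).comp (hX.measurable_chain t)).mul (he _ _))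
    exact measurableSet_lt hΦm measurable_const
  · have hmk := mul_meas_ge_le_integral_of_nonneg (Filter.Eventually.of_forall hΦ0) hint
      ((n : ℝ) ^ 6)
    have hc : {ω | Φ ω < (n : ℝ) ^ 6}ᶜ = {ω | (n : ℝ) ^ 6 ≤ Φ ω} := by
      ext ω; simp
    rw [hc, le_div_iff₀ hn0]
    -- Markov's inequality, with `(2n + 1) * 2n² ≤ n ^ 5` for `n ≥ 4`.
    have h5 : (n : ℝ) ^ 6 * P.real {ω | (n : ℝ) ^ 6 ≤ Φ ω} ≤ (n : ℝ) ^ 5 := by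
      refine (hmk.trans hEΦ).trans ?_
      have : (16 : ℝ) ≤ (n : ℝ) ^ 2 := by nlinarith
      have h3 : (0 : ℝ) ≤ (n : ℝ) ^ 3 := by positivity
      nlinarith [mul_le_mul_of_nonneg_left this h3, pow_pos hn0 2]
    have h6 : (n : ℝ) ^ 5 * (P.real {ω | (n : ℝ) ^ 6 ≤ Φ ω} * n) ≤ (n : ℝ) ^ 5 * 1 := by
      calc _ = (n : ℝ) ^ 6 * P.real {ω | (n : ℝ) ^ 6 ≤ Φ ω} := by ring
        _ ≤ _ := by rw [mul_one]; exact h5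
    exact le_of_mul_le_mul_left h6 (by positivity)
  · intro ω hω j hj K hK l hl0 hl1
    have hterm : ∀ t < n, ∀ k < n, weightedProc μ s X n K t k ω ≤ (n : ℝ) ^ 6 := by
      intro t ht k hk
      refine le_trans ?_ (le_of_lt hω)
      refine le_trans ?_ (Finset.single_le_sum (f := fun j => ∑ t ∈ Finset.range n,
        ∑ k ∈ Finset.range n, ∑ K ∈ regular d j, weightedProc μ s X n K t k ω)
        (fun j _ => Finset.sum_nonneg fun t _ => Finset.sum_nonneg fun k _ =>
          Finset.sum_nonneg fun K _ => hw K t k ω) (Finset.mem_range.2 (Nat.lt_succ_of_le hj)))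
      refine le_trans ?_ (Finset.single_le_sum (f := fun t =>
        ∑ k ∈ Finset.range n, ∑ K ∈ regular d j, weightedProc μ s X n K t k ω)
        (fun t _ => Finset.sum_nonneg fun k _ =>
          Finset.sum_nonneg fun K _ => hw K t k ω) (Finset.mem_range.2 ht))
      refine le_trans ?_ (Finset.single_le_sum (f := fun k =>
        ∑ K ∈ regular d j, weightedProc μ s X n K t k ω)
        (fun k _ => Finset.sum_nonneg fun K _ => hw K t k ω) (Finset.mem_range.2 hk))
      exact Finset.single_le_sum (f := fun K => weightedProc μ s X n K t k ω)
        (fun K _ => hw K t k ω) hK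
    refine abs_sum_sub_sum_le hn (fun i => ind_eq_zero_or_one _ _ _)
      (fun i => hX.drift_nonneg _ _) (fun i => hX.drift_le_one (hmeas K hK).1 _)
      (fun t ht k hk => le_trans ?_ (hterm t ht k hk))
      (fun t ht k hk => le_trans ?_ (hterm t ht k hk)) hl0 hl1
    · exact le_add_of_nonneg_right (mul_nonneg (hX.drift_nonneg _ _) (expProc_pos _ _ _ _ _).le)
    · exact le_add_of_nonneg_left (mul_nonneg (ind_nonneg _ _ _) (expProc_pos _ _ _ _ _).le)

end IsMarkovChainWithDensity

end

section

/-! ### Inequalities on a single cell -/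

/-- The weight of a transition in the test of `b` against `a`. -/
def psi (a b : ℝ) : ℝ := (√b - √a) / (√2 * √(a + b))

/-- The test of the constant `b` against the constant `a` on a cell of mass `M` which contains
`N` transitions. -/
def cellTest (a b M N : ℝ) : ℝ :=
  alpha * (M * (√a - √b) ^ 2 / 2) + (M * (√((a + b) / 2) * (√b - √a)) / 2 + psi a b * N +
    M * (a - b) / 2)

lemma psi_eq (a b : ℝ) :
    psi a b = (√b - √a) / (2 * √((a + b) / 2)) := by
  have h : √2 * √(a + b) = 2 * √((a + b) / 2) := by
    have e : a + b = 2 * ((a + b) / 2) := by ring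
    conv_lhs => rw [e, Real.sqrt_mul zero_le_two, ← mul_assoc, Real.mul_self_sqrt zero_le_two]
  rw [psi, h]

lemma sq_sqrt_sub_le {a b : ℝ} (ha : 0 ≤ a) (hb : 0 ≤ b) : (√b - √a) ^ 2 ≤ a + b := by
  have h1 := Real.sq_sqrt ha
  have h2 := Real.sq_sqrt hb
  nlinarith [mul_nonneg (Real.sqrt_nonneg a) (Real.sqrt_nonneg b)]

lemma sq_psi_le_one {a b : ℝ} (ha : 0 ≤ a) (hb : 0 ≤ b) : psi a b ^ 2 ≤ 1 := by
  rw [psi, div_pow, mul_pow, Real.sq_sqrt zero_le_two, Real.sq_sqrt (add_nonneg ha hb)]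
  refine div_le_one_of_le₀ ?_ (by positivity)
  linarith [sq_sqrt_sub_le ha hb]

lemma abs_psi_le_one {a b : ℝ} (ha : 0 ≤ a) (hb : 0 ≤ b) : |psi a b| ≤ 1 := by
  rw [← sq_le_one_iff_abs_le_one]; exact sq_psi_le_one ha hb

lemma alpha_bounds : 1 / 8 < alpha ∧ alpha < 3 / 20 := by
  have h : √2 * √2 = 2 := Real.mul_self_sqrt zero_le_two
  have h0 : 0 < √2 := by positivity
  have e : 1 / √2 = √2 / 2 := by field_simp; linarith
  unfold alpha
  rw [e]
  constructor <;> nlinarith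

/-- Write `x = (√S - √a)²` and `y = (√S - √b)²`. The terms other than those with `alpha` and `1/50`
are at most `(1 - α) x - α y`. The negative multiple of `y` pays for the Hellinger term and for the
variance term `psi² S / 50`, which is kept on the left to absorb the random fluctuations. -/
lemma cellTest_pointwise {a b S : ℝ} (ha : 0 ≤ a) (hb : 0 ≤ b) (hS : 0 ≤ S) :
    alpha * ((√a - √b) ^ 2 / 2) + (√((a + b) / 2) * (√b - √a) / 2 + psi a b * S + (a - b) / 2) +
      psi a b ^ 2 * S / 50 ≤ 3 / 2 * (√S - √a) ^ 2 := by
  rw [psi_eq]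
  set p := √a
  set q := √b
  set r := √S
  set Q := √((a + b) / 2)
  have hp : p ^ 2 = a := Real.sq_sqrt ha
  have hq : q ^ 2 = b := Real.sq_sqrt hb
  have hr : r ^ 2 = S := Real.sq_sqrt hS
  have hQ : Q ^ 2 = (a + b) / 2 := Real.sq_sqrt (by positivity)
  have hp0 : 0 ≤ p := Real.sqrt_nonneg _
  have hq0 : 0 ≤ q := Real.sqrt_nonneg _
  have hr0 : 0 ≤ r := Real.sqrt_nonneg _
  have hQ0 : 0 ≤ Q := Real.sqrt_nonneg _
  have h2 : √2 * √2 = 2 := Real.mul_self_sqrt zero_le_two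
  have h20 : 0 < √2 := by positivity
  have halpha : alpha = 1 / 2 - √2 / 4 := by
    have e : 1 / √2 = √2 / 2 := by field_simp; linarith
    unfold alpha; rw [e]; ring
  rcases hQ0.eq_or_lt with hz | hQpos
  · have hab : a + b = 0 := by rw [← hz] at hQ; linarith
    have ha' : a = 0 := by linarith
    have hb' : b = 0 := by linarith
    have hp' : p = 0 := by simp only [p, ha', Real.sqrt_zero]
    have hq' : q = 0 := by simp only [q, hb', Real.sqrt_zero]
    rw [hp', hq', ha', hb']
    simp only [sub_zero, zero_div, zero_mul, mul_zero, add_zero, ne_eq, OfNat.ofNat_ne_zero,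
      not_false_eq_true, zero_pow]
    positivity
  set w := (q - p) / Q with hw
  have hwQ : w * Q = q - p := by rw [hw]; field_simp
  have hw2 : (q - p) / (2 * Q) = w / 2 := by rw [hw]; field_simp
  rw [hw2, ← hr, ← hp, ← hq]
  have hQ' : Q ^ 2 = (p ^ 2 + q ^ 2) / 2 := by rw [hp, hq]; exact hQ
  have hpq : p + q ≤ 2 * Q := by
    refine le_of_sq_le_sq ?_ (by positivity)
    nlinarith only [sq_nonneg (p - q), hQ']
  have hwsq : w ^ 2 ≤ 2 := by
    have : w ^ 2 * Q ^ 2 ≤ 2 * Q ^ 2 := by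
      rw [← mul_pow, hwQ]; nlinarith only [mul_nonneg hp0 hq0, hQ']
    exact le_of_mul_le_mul_right this (by positivity)
  have hwle : w ≤ √2 := Real.le_sqrt_of_sq_le hwsq
  -- the Hellinger-type expansion of the test
  have hid : Q * (q - p) / 2 + w / 2 * r ^ 2 + (p ^ 2 - q ^ 2) / 2 =
      (r - p) ^ 2 / 2 - (r - q) ^ 2 / 2 + w * (r - Q) ^ 2 / 2 := by
    linear_combination (r - Q / 2) * hwQ
  have hrQ : (r - Q) ^ 2 ≤ ((r - p) ^ 2 + (r - q) ^ 2) / 2 := by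
    nlinarith only [mul_le_mul_of_nonneg_left hpq hr0, hQ']
  have hwr : w * (r - Q) ^ 2 ≤ √2 * (((r - p) ^ 2 + (r - q) ^ 2) / 2) :=
    (mul_le_mul_of_nonneg_right hwle (sq_nonneg _)).trans
      (mul_le_mul_of_nonneg_left hrQ h20.le)
  have hvar : (w / 2) ^ 2 * r ^ 2 ≤ (r - Q) ^ 2 + (q - p) ^ 2 / 2 := by
    have e1 : r ^ 2 ≤ 2 * (r - Q) ^ 2 + 2 * Q ^ 2 := by nlinarith only [sq_nonneg (r - 2 * Q)]
    have e2 : w ^ 2 * r ^ 2 ≤ w ^ 2 * (2 * (r - Q) ^ 2 + 2 * Q ^ 2) :=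
      mul_le_mul_of_nonneg_left e1 (sq_nonneg _)
    have e3 : w ^ 2 * (r - Q) ^ 2 ≤ 2 * (r - Q) ^ 2 :=
      mul_le_mul_of_nonneg_right hwsq (sq_nonneg _)
    have e4 : w ^ 2 * Q ^ 2 = (q - p) ^ 2 := by rw [← mul_pow, hwQ]
    have e5 : w ^ 2 * (2 * (r - Q) ^ 2 + 2 * Q ^ 2) =
      2 * (w ^ 2 * (r - Q) ^ 2) + 2 * (w ^ 2 * Q ^ 2) := by ring
    have e6 : (w / 2) ^ 2 * r ^ 2 = w ^ 2 * r ^ 2 / 4 := by ring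
    linarith
  -- With weights `3` and `3/2`, the Hellinger term uses `3α/4` of the available `α` in front of `(r
  -- - q)²`; the remaining `α/4` exceeds what the variance term needs.
  have htri : (p - q) ^ 2 ≤ 3 * (r - p) ^ 2 + 3 / 2 * (r - q) ^ 2 := by
    have e : 3 * (r - p) ^ 2 + 3 / 2 * (r - q) ^ 2 - (p - q) ^ 2 =
      (2 * (r - p) + (r - q)) ^ 2 / 2 := by ring
    have := sq_nonneg (2 * (r - p) + (r - q))
    linarith
  have hs1 : √2 < 1.415 := by nlinarith only [h2, h20]
  have hs2 : 1.414 < √2 := by nlinarith only [h2, h20]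
  have hx := sq_nonneg (r - p)
  have hy := sq_nonneg (r - q)
  have ha1 := mul_le_mul_of_nonneg_left htri (show 0 ≤ alpha / 2 by linarith [alpha_bounds.1])
  rw [halpha] at ha1 ⊢
  have hqp : (q - p) ^ 2 = (p - q) ^ 2 := by ring
  have b1 := mul_nonneg hx (sub_nonneg.2 hs1.le)
  have b2 := mul_nonneg hy (sub_nonneg.2 hs1.le)
  have b3 := mul_nonneg hx (sub_nonneg.2 hs2.le)
  have b4 := mul_nonneg hy (sub_nonneg.2 hs2.le)
  rw [hqp] at hvar
  generalize (r - p) ^ 2 = x at *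
  generalize (r - q) ^ 2 = y at *
  generalize (p - q) ^ 2 = v at *
  generalize (r - Q) ^ 2 = ρ at *
  nlinarith only [b1, b2, b3, b4, ha1, hvar, htri, hwr, hrQ, hid, hx, hy]

/-- A crude bound that needs no concentration, for partitions that are too fine. -/
lemma cellTest_le_add {a b M N : ℝ} (ha : 0 ≤ a) (hb : 0 ≤ b) (hM : 0 ≤ M) (hN : 0 ≤ N) :
    cellTest a b M N ≤ (a + b) * M + N := by
  have h1 := sq_sqrt_sub_le hb ha
  have h2 : √((a + b) / 2) * (√b - √a) ≤ 3 / 4 * (a + b) := by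
    have e := sq_sqrt_sub_le ha hb
    have e2 : √((a + b) / 2) ^ 2 = (a + b) / 2 := Real.sq_sqrt (by positivity)
    nlinarith [sq_nonneg (√((a + b) / 2) - (√b - √a))]
  have h3 : psi a b * N ≤ N :=
    mul_le_of_le_one_left hN ((le_abs_self _).trans (abs_psi_le_one ha hb))
  have h4 : alpha * (M * (√a - √b) ^ 2 / 2) ≤ 3 / 20 * (M * (a + b) / 2) := by
    refine mul_le_mul alpha_bounds.2.le ?_ (by positivity) (by norm_num)
    rw [add_comm a b]; gcongr
  have h5 := mul_le_mul_of_nonneg_left h2 hM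
  unfold cellTest
  nlinarith [mul_nonneg ha hM, mul_nonneg hb hM]

/-- The choice `l = |p| / 50` turns the linear term into the margin `p² V / 50` of
`cellTest_pointwise`, and the other term into `100 u`. -/
lemma psi_mul_sub_le {p N V u : ℝ} (hu : 0 ≤ u) (hp : |p| ≤ 1)
    (h : ∀ l : ℝ, 0 < l → l ≤ 1 → |N - V| ≤ l * V + 2 * u / l) :
    p * (N - V) ≤ p ^ 2 * V / 50 + 100 * u := by
  rcases eq_or_ne p 0 with rfl | hp0
  · simp; exact hu
  have hpos : 0 < |p| := abs_pos.2 hp0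
  calc p * (N - V) ≤ |p| * |N - V| := by rw [← abs_mul]; exact le_abs_self _
    _ ≤ |p| * (|p| / 50 * V + 2 * u / (|p| / 50)) := by
        gcongr
        exact h _ (by positivity) (by linarith)
    _ = |p| ^ 2 * V / 50 + 100 * u := by field_simp; ring
    _ = _ := by rw [sq_abs]

/-- If `u ≤ V`, the choice `l = √u / √V` gives `|N - V| ≤ 3 √u √V`, to be divided by `√N + √V ≥ √V`.
If `V < u`, then `l = 1` gives `N ≤ 4u`. -/
lemma sq_sqrt_sub_sqrt_le {N V u : ℝ} (hN : 0 ≤ N) (hV : 0 ≤ V) (hu : 0 < u)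
    (h : ∀ l : ℝ, 0 < l → l ≤ 1 → |N - V| ≤ l * V + 2 * u / l) :
    (√N - √V) ^ 2 ≤ 9 * u := by
  have hN2 := Real.sq_sqrt hN
  have hV2 := Real.sq_sqrt hV
  have hu2 := Real.sq_sqrt hu.le
  have hN0 := Real.sqrt_nonneg N
  have hV0 := Real.sqrt_nonneg V
  have hu0 : 0 < √u := Real.sqrt_pos.2 hu
  rcases le_or_gt u V with huV | huV
  · have hVpos : 0 < √V := Real.sqrt_pos.2 (hu.trans_le huV)
    have hle : √u ≤ √V := Real.sqrt_le_sqrt huV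
    have := h (√u / √V) (by positivity) ((div_le_one hVpos).2 hle)
    have e : √u / √V * V + 2 * u / (√u / √V) = 3 * (√u * √V) := by
      have h1 : √u / √V * V = √u * √V := by
        rw [div_mul_eq_mul_div, div_eq_iff hVpos.ne']; rw [mul_assoc, ← sq, hV2]
      have h2 : 2 * u / (√u / √V) = 2 * (√u * √V) := by
        rw [div_div_eq_mul_div, div_eq_iff hu0.ne']
        nth_rewrite 1 [← hu2]; ring
      rw [h1, h2]; ring
    rw [e] at this
    have e2 : |N - V| = |√N - √V| * (√N + √V) := by
      rw [← abs_of_nonneg (add_nonneg hN0 hV0), ← abs_mul]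
      congr 1
      nlinarith
    rw [e2] at this
    have h3 : |√N - √V| * √V ≤ 3 * √u * √V := by
      have := mul_nonneg (abs_nonneg (√N - √V)) hN0
      linarith
    have h4 : |√N - √V| ≤ 3 * √u := le_of_mul_le_mul_right h3 hVpos
    calc (√N - √V) ^ 2 = |√N - √V| ^ 2 := (sq_abs _).symm
      _ ≤ (3 * √u) ^ 2 := by gcongr
      _ = 9 * u := by rw [mul_pow, hu2]; norm_num
  · have := h 1 one_pos le_rfl
    have := (abs_le.1 this).2
    have hNle : N ≤ 4 * u := by linarith
    nlinarith [mul_nonneg hN0 hV0]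

end

section

variable {d : ℕ}

/-! ### The empirical measure of a path -/

/-- The measure `∑_{i < n} δ_{x i} ⊗ μ` restricted to states in the unit cube at the second
time. -/
def occ (μ : Measure (State d)) (n : ℕ) (x : ℕ → State d) : Measure (Pt d) :=
  ∑ i ∈ Finset.range n, (μ.restrict (Icc 0 1)).map (Sum.elim (x i))

/-- The transition density as a function on `ℝ^{2d}`. -/
def dens (s : State d → State d → ℝ) (z : Pt d) : ℝ := s (z ∘ Sum.inl) (z ∘ Sum.inr)

lemma dens_sumElim (s : State d → State d → ℝ) (u v : State d) : dens s (Sum.elim u v) = s u v :=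
  rfl

lemma measurable_sumElim_right (u : State d) : Measurable (Sum.elim u : State d → Pt d) :=
  measurable_sumElim.comp (measurable_const.prodMk measurable_id)

lemma ind_eq_zero_of_notMem {K : Set (Pt d)} (hKA : K ⊆ Icc 0 1) {u v : State d}
    (hv : v ∉ Icc (0 : State d) 1) : ind K u v = 0 := by
  refine Set.indicator_of_notMem (fun h => hv ?_) _
  exact ⟨fun i => (hKA h).1 (Sum.inr i), fun i => (hKA h).2 (Sum.inr i)⟩

section Occ

variable {μ : Measure (State d)} (hμ : μ (Icc 0 1) = 1) (n : ℕ) (x : ℕ → State d)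
include hμ

lemma isProbabilityMeasure_restrict : IsProbabilityMeasure (μ.restrict (Icc 0 1)) :=
  ⟨by simp [hμ]⟩

lemma occ_univ : occ μ n x univ = n := by
  have := isProbabilityMeasure_restrict hμ
  have h : ∀ i, (μ.restrict (Icc 0 1)).map (Sum.elim (x i) : State d → Pt d) univ = 1 := fun i => by
    rw [Measure.map_apply (measurable_sumElim_right _) MeasurableSet.univ]; simp
  simp [occ, Measure.finsetSum_apply, h]

lemma isFiniteMeasure_occ : IsFiniteMeasure (occ μ n x) :=
  ⟨by rw [occ_univ hμ]; exact ENNReal.natCast_lt_top n⟩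

lemma occ_real_le (K : Set (Pt d)) : (occ μ n x).real K ≤ n := by
  have := isFiniteMeasure_occ hμ n x
  refine (measureReal_mono (subset_univ K)).trans (le_of_eq ?_)
  rw [measureReal_def, occ_univ hμ]; simp

omit hμ in
lemma integrable_occ {g : Pt d → ℝ} (hg : Measurable g)
    (hi : ∀ i, IntegrableOn (fun y => g (Sum.elim (x i) y)) (Icc 0 1) μ) :
    Integrable g (occ μ n x) := by
  unfold occ
  rw [integrable_finsetSum_measure]
  intro i _
  exact (integrable_map_measure hg.aestronglyMeasurable
    (measurable_sumElim_right _).aemeasurable).2 (hi i)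

-- Sums of integrals along the path become set integrals for a single measure on pairs, so that
-- losses and masses are additive over cells.
omit hμ in
lemma sum_integral_mul_ind {g : Pt d → ℝ} (hg : Measurable g) (hi : Integrable g (occ μ n x))
    {K : Set (Pt d)} (hK : MeasurableSet K) (hKA : K ⊆ Icc 0 1) :
    ∑ i ∈ Finset.range n, ∫ y, g (Sum.elim (x i) y) * ind K (x i) y ∂μ =
      ∫ z in K, g z ∂(occ μ n x) := by
  rw [← integral_indicator hK]
  have hi' : Integrable (K.indicator g) (occ μ n x) := hi.indicator hK
  unfold occ at hi' ⊢
  rw [integrable_finsetSum_measure] at hi'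
  rw [integral_finsetSum_measure hi']
  refine Finset.sum_congr rfl fun i _ => ?_
  rw [integral_map (measurable_sumElim_right _).aemeasurable
    (hg.indicator hK).aestronglyMeasurable]
  rw [setIntegral_eq_integral_of_forall_compl_eq_zero]
  · congr 1
    funext y
    by_cases h : Sum.elim (x i) y ∈ K <;> simp [ind, h]
  · intro y hy
    have h0 := ind_eq_zero_of_notMem hKA (u := x i) hy
    by_cases h : Sum.elim (x i) y ∈ K
    · simp [ind, h] at h0
    · simp [h]

lemma sum_integral_ind {K : Set (Pt d)} (hK : MeasurableSet K) (hKA : K ⊆ Icc 0 1) :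
    ∑ i ∈ Finset.range n, ∫ y, ind K (x i) y ∂μ = (occ μ n x).real K := by
  have := isFiniteMeasure_occ hμ n x
  have h := sum_integral_mul_ind (μ := μ) n x (g := fun _ => 1) measurable_const
    (integrable_const _) hK hKA
  simpa using h

omit hμ in
lemma setIntegral_ind {K : Set (Pt d)} (hKA : K ⊆ Icc 0 1) (u : State d) :
    ∫ y in Icc (0 : State d) 1, ind K u y ∂μ = ∫ y, ind K u y ∂μ :=
  setIntegral_eq_integral_of_forall_compl_eq_zero fun _ hy => ind_eq_zero_of_notMem hKA hy

lemma hellSq_const {K : Set (Pt d)} (hK : MeasurableSet K) (hKA : K ⊆ Icc 0 1) (a b : ℝ) :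
    hellSq μ n x (fun u v => a * ind K u v) (fun u v => b * ind K u v) =
      1 / n * ((occ μ n x).real K * (√a - √b) ^ 2 / 2) := by
  have h : ∀ i, ∫ y, (√(a * ind K (x i) y) - √(b * ind K (x i) y)) ^ 2 ∂μ =
      (√a - √b) ^ 2 * ∫ y, ind K (x i) y ∂μ := fun i => by
    rw [← integral_const_mul]
    congr 1
    funext y
    rcases ind_eq_zero_or_one K (x i) y with h | h <;> simp [h]
  unfold hellSq
  simp only [h]
  rw [← Finset.mul_sum, sum_integral_ind hμ n x hK hKA]
  ring

lemma testT_const {K : Set (Pt d)} (hK : MeasurableSet K) (hKA : K ⊆ Icc 0 1) (a b : ℝ) :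
    testT μ n x (fun u v => a * ind K u v) (fun u v => b * ind K u v) =
      1 / n * ((occ μ n x).real K * (√((a + b) / 2) * (√b - √a)) / 2 + psi a b * hits n x K +
        (occ μ n x).real K * (a - b) / 2) := by
  have h1 : ∀ i, ∫ y, √(a * ind K (x i) y + b * ind K (x i) y) *
      (√(b * ind K (x i) y) - √(a * ind K (x i) y)) ∂μ =
      (√(a + b) * (√b - √a)) * ∫ y, ind K (x i) y ∂μ := fun i => by
    rw [← integral_const_mul]
    congr 1
    funext y
    rcases ind_eq_zero_or_one K (x i) y with h | h <;> simp [h]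
  -- Outside `K` the quotient is `0 / 0 = 0`, as in the convention for `T`.
  have h2 : ∀ i, (√(b * ind K (x i) (x (i + 1))) - √(a * ind K (x i) (x (i + 1)))) /
      √(a * ind K (x i) (x (i + 1)) + b * ind K (x i) (x (i + 1))) =
      ((√b - √a) / √(a + b)) * ind K (x i) (x (i + 1)) := fun i => by
    rcases ind_eq_zero_or_one K (x i) (x (i + 1)) with h | h <;> simp [h]
  have h3 : ∀ i, ∫ y, (a * ind K (x i) y - b * ind K (x i) y) ∂μ =
      (a - b) * ∫ y, ind K (x i) y ∂μ := fun i => by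
    rw [← integral_const_mul]
    congr 1
    funext y
    ring
  have h4 : √((a + b) / 2) = √(a + b) / √2 := Real.sqrt_div' _ zero_le_two
  unfold testT
  simp only [h1, h2, h3]
  rw [← Finset.mul_sum, ← Finset.mul_sum, ← Finset.mul_sum, sum_integral_ind hμ n x hK hKA, h4, psi,
    hits]
  ring

lemma alpha_mul_hellSq_add_testT_const {K : Set (Pt d)} (hK : MeasurableSet K)
    (hKA : K ⊆ Icc 0 1) (a b : ℝ) :
    alpha * hellSq μ n x (fun u v => a * ind K u v) (fun u v => b * ind K u v) +
      testT μ n x (fun u v => a * ind K u v) (fun u v => b * ind K u v) =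
      1 / n * cellTest a b ((occ μ n x).real K) (hits n x K) := by
  rw [hellSq_const hμ n x hK hKA, testT_const hμ n x hK hKA, cellTest]
  ring

end Occ

lemma hits_nonneg (n : ℕ) (x : ℕ → State d) (K : Set (Pt d)) : 0 ≤ hits n x K :=
  Finset.sum_nonneg fun _ _ => ind_nonneg _ _ _

lemma IsDyadicPartition.measurableSet {m : Finset (Set (Pt d))} (hm : IsDyadicPartition m)
    {K : Set (Pt d)} (hK : K ∈ m) : MeasurableSet K := by
  obtain ⟨j, z, -, rfl⟩ := hm.exists_cell K hK
  exact measurableSet_cell j z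

lemma IsDyadicPartition.sum_hits_le {m : Finset (Set (Pt d))} (hm : IsDyadicPartition m) (n : ℕ)
    (x : ℕ → State d) : ∑ K ∈ m, hits n x K ≤ n := by
  unfold hits
  rw [Finset.sum_comm]
  calc _ ≤ ∑ i ∈ Finset.range n, (1 : ℝ) := Finset.sum_le_sum fun i _ => hm.sum_ind_le_one _ _
    _ = n := by simp

/-- A set integral over a part of the unit cube splits along a dyadic partition. -/
lemma IsDyadicPartition.sum_setIntegral_inter {m : Finset (Set (Pt d))} (hm : IsDyadicPartition m)
    {ν : Measure (Pt d)} {g : Pt d → ℝ} (hg : Integrable g ν) {K : Set (Pt d)}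
    (hK : MeasurableSet K) (hKA : K ⊆ Icc 0 1) :
    ∑ K' ∈ m, ∫ z in K ∩ K', g z ∂ν = ∫ z in K, g z ∂ν := by
  rw [← integral_biUnion_finset m (fun K' hK' => hK.inter (hm.measurableSet hK')) ?_
    fun K' _ => hg.integrableOn]
  · congr 2
    ext z
    simp only [mem_iUnion, mem_inter_iff, exists_prop]
    constructor
    · rintro ⟨K', -, h, -⟩; exact h
    · intro h
      obtain ⟨K', hK', hz⟩ := hm.exists_mem z (hKA h)
      exact ⟨K', hK', h, hz⟩
  · intro K₁ h₁ K₂ h₂ hne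
    rw [Function.onFun, Set.disjoint_left]
    rintro z ⟨-, hz₁⟩ ⟨-, hz₂⟩
    exact hne (hm.eq_of_mem _ h₁ _ h₂ z hz₁ hz₂)

lemma IsDyadicPartition.sum_measureReal_inter {m : Finset (Set (Pt d))} (hm : IsDyadicPartition m)
    {ν : Measure (Pt d)} [IsFiniteMeasure ν] {K : Set (Pt d)}
    (hK : MeasurableSet K) (hKA : K ⊆ Icc 0 1) :
    ∑ K' ∈ m, ν.real (K ∩ K') = ν.real K := by
  have := hm.sum_setIntegral_inter (ν := ν) (g := fun _ => 1) (integrable_const _) hK hKA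
  simpa using this

/-! ### The loss on a cell -/

/-- The squared distance between the square roots of the density and of the constant `a` on `K`. -/
def cellLoss (μ : Measure (State d)) (s : State d → State d → ℝ) (n : ℕ) (x : ℕ → State d) (a : ℝ)
    (K : Set (Pt d)) : ℝ :=
  ∫ z in K, (√(dens s z) - √a) ^ 2 ∂(occ μ n x)

section Loss

variable {Ω : Type*} [MeasurableSpace Ω] {P : Measure Ω}
  {μ : Measure (State d)} {s : State d → State d → ℝ} {X : ℕ → Ω → State d}

namespace IsMarkovChainWithDensity

variable (hX : IsMarkovChainWithDensity P μ s X)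
include hX

lemma measurable_dens : Measurable (dens s) := by
  have h1 : Measurable fun z : Pt d => z ∘ Sum.inl :=
    measurable_pi_lambda _ fun i => measurable_pi_apply (Sum.inl i)
  have h2 : Measurable fun z : Pt d => z ∘ Sum.inr :=
    measurable_pi_lambda _ fun i => measurable_pi_apply (Sum.inr i)
  exact hX.measurable_density.comp (h1.prodMk h2)

lemma dens_nonneg (z : Pt d) : 0 ≤ dens s z := hX.nonneg _ _

lemma integrable_dens (n : ℕ) (x : ℕ → State d) : Integrable (dens s) (occ μ n x) :=
  integrable_occ n x hX.measurable_dens fun i => (hX.integrable_density (x i)).integrableOn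

lemma compensator_eq (n : ℕ) (x : ℕ → State d) {K : Set (Pt d)} (hK : MeasurableSet K)
    (hKA : K ⊆ Icc 0 1) : compensator μ s n x K = ∫ z in K, dens s z ∂(occ μ n x) := by
  rw [← sum_integral_mul_ind n x hX.measurable_dens (hX.integrable_dens n x) hK hKA]
  rfl

lemma compensator_nonneg (n : ℕ) (x : ℕ → State d) (K : Set (Pt d)) :
    0 ≤ compensator μ s n x K := Finset.sum_nonneg fun _ _ => hX.drift_nonneg _ _

lemma sq_sqrt_dens_sub_le {a : ℝ} (ha : 0 ≤ a) (z : Pt d) :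
    (√(dens s z) - √a) ^ 2 ≤ a + dens s z := sq_sqrt_sub_le ha (hX.dens_nonneg z)

lemma integrable_sq_sqrt_dens_sub (hμ : μ (Icc 0 1) = 1) (n : ℕ) (x : ℕ → State d) {a : ℝ}
    (ha : 0 ≤ a) : Integrable (fun z => (√(dens s z) - √a) ^ 2) (occ μ n x) := by
  have := isFiniteMeasure_occ hμ n x
  refine ((integrable_const a).add (hX.integrable_dens n x)).mono'
    ((hX.measurable_dens.sqrt.sub_const _).pow_const 2).aestronglyMeasurable
    (Filter.Eventually.of_forall fun z => ?_)
  rw [Real.norm_of_nonneg (sq_nonneg _)]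
  exact hX.sq_sqrt_dens_sub_le ha z

omit hX in
lemma cellLoss_nonneg (n : ℕ) (x : ℕ → State d) (a : ℝ) (K : Set (Pt d)) :
    0 ≤ cellLoss μ s n x a K := integral_nonneg fun _ => sq_nonneg _

lemma cellLoss_le (hμ : μ (Icc 0 1) = 1) (n : ℕ) (x : ℕ → State d) {a : ℝ} (ha : 0 ≤ a)
    {K : Set (Pt d)} (hK : MeasurableSet K) (hKA : K ⊆ Icc 0 1) :
    cellLoss μ s n x a K ≤ a * (occ μ n x).real K + compensator μ s n x K := by
  have := isFiniteMeasure_occ hμ n x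
  rw [hX.compensator_eq n x hK hKA]
  refine (setIntegral_mono (hX.integrable_sq_sqrt_dens_sub hμ n x ha).integrableOn
    ((integrable_const a).add (hX.integrable_dens n x)).integrableOn
    (hX.sq_sqrt_dens_sub_le ha)).trans (le_of_eq ?_)
  rw [integral_add' (integrable_const a) (hX.integrable_dens n x).integrableOn]
  simp [mul_comm]

lemma cellLoss_triangle (hμ : μ (Icc 0 1) = 1) (n : ℕ) (x : ℕ → State d) {a b : ℝ} (ha : 0 ≤ a)
    (hb : 0 ≤ b) (K : Set (Pt d)) :
    cellLoss μ s n x a K ≤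
      2 * cellLoss μ s n x b K + 2 * ((occ μ n x).real K * (√a - √b) ^ 2) := by
  have := isFiniteMeasure_occ hμ n x
  have hb' := hX.integrable_sq_sqrt_dens_sub hμ n x hb
  calc cellLoss μ s n x a K ≤ ∫ z in K, (2 * (√(dens s z) - √b) ^ 2 + 2 * (√a - √b) ^ 2)
        ∂(occ μ n x) := by
        refine setIntegral_mono (hX.integrable_sq_sqrt_dens_sub hμ n x ha).integrableOn
          ((hb'.const_mul 2).add (integrable_const _)).integrableOn fun z => ?_
        nlinarith [sq_nonneg ((√(dens s z) - √b) + (√a - √b))]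
    _ = _ := by
        rw [integral_add (hb'.const_mul 2).integrableOn (integrable_const _), integral_const_mul,
          cellLoss]
        simp
        ring

/-- The test on a cell is controlled by the loss of the first constant. -/
lemma cellTest_le (hμ : μ (Icc 0 1) = 1) {n : ℕ} (x : ℕ → State d) {a b u : ℝ} (ha : 0 ≤ a)
    (hb : 0 ≤ b) (hu : 0 ≤ u) {K : Set (Pt d)} (hK : MeasurableSet K) (hKA : K ⊆ Icc 0 1)
    (h : ∀ l : ℝ, 0 < l → l ≤ 1 → |hits n x K - compensator μ s n x K| ≤
      l * compensator μ s n x K + 2 * u / l) :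
    cellTest a b ((occ μ n x).real K) (hits n x K) ≤
      3 / 2 * cellLoss μ s n x a K + 100 * u := by
  have := isFiniteMeasure_occ hμ n x
  have hdev := psi_mul_sub_le hu (abs_psi_le_one ha hb) h
  -- The left side of `cellTest_pointwise` is affine in `S`, so its integral over `K` involves only
  -- the mass and the compensator.
  set c₀ := alpha * ((√a - √b) ^ 2 / 2) + (√((a + b) / 2) * (√b - √a) / 2 + (a - b) / 2) with hc₀
  set c₁ := psi a b + psi a b ^ 2 / 50 with hc₁
  have hint : ∫ z in K, (c₀ + c₁ * dens s z) ∂(occ μ n x) ≤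
      ∫ z in K, 3 / 2 * (√(dens s z) - √a) ^ 2 ∂(occ μ n x) := by
    refine setIntegral_mono
      ((integrable_const _).add ((hX.integrable_dens n x).const_mul _)).integrableOn
      ((hX.integrable_sq_sqrt_dens_sub hμ n x ha).const_mul _).integrableOn fun z => ?_
    refine le_trans (le_of_eq ?_) (cellTest_pointwise ha hb (hX.dens_nonneg z))
    rw [hc₀, hc₁]; ring
  rw [integral_add (integrable_const _) ((hX.integrable_dens n x).const_mul _).integrableOn,
    integral_const_mul, integral_const_mul, ← hX.compensator_eq n x hK hKA] at hint
  simp only [integral_const, smul_eq_mul, measureReal_restrict_apply_univ] at hint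
  change _ ≤ 3 / 2 * cellLoss μ s n x a K at hint
  rw [hc₀, hc₁] at hint
  unfold cellTest
  linarith

end IsMarkovChainWithDensity

end Loss

end

section

variable {d : ℕ}

/-! ### Histograms -/

/-- The value of the estimator on the cell `K`. -/
def coef (μ : Measure (State d)) (n : ℕ) (x : ℕ → State d) (K : Set (Pt d)) : ℝ :=
  hits n x K / (occ μ n x).real K

lemma coef_nonneg (μ : Measure (State d)) (n : ℕ) (x : ℕ → State d) (K : Set (Pt d)) :
    0 ≤ coef μ n x K := div_nonneg (hits_nonneg n x K) measureReal_nonneg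

/-- Only an inequality: on a cell of mass zero the quotient is `0` by convention, whatever the
number of hits. -/
lemma coef_mul_le (μ : Measure (State d)) (n : ℕ) (x : ℕ → State d) (K : Set (Pt d)) :
    coef μ n x K * (occ μ n x).real K ≤ hits n x K := by
  rcases eq_or_ne ((occ μ n x).real K) 0 with h | h
  · rw [h, mul_zero]; exact hits_nonneg n x K
  · rw [coef, div_mul_cancel₀ _ h]

lemma pieceEst_eq {μ : Measure (State d)} (hμ : μ (Icc 0 1) = 1) (n : ℕ) (x : ℕ → State d)
    {m : Finset (Set (Pt d))} (hm : IsDyadicPartition m) (u v : State d) :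
    pieceEst μ n x m u v = ∑ K ∈ m, coef μ n x K * ind K u v := by
  refine Finset.sum_congr rfl fun K hK => ?_
  simp only [setIntegral_ind (hm.subset_Icc hK)]
  rw [sum_integral_ind hμ n x (hm.measurableSet hK) (hm.subset_Icc hK)]
  rfl

lemma pieceEst_of_mem {μ : Measure (State d)} (hμ : μ (Icc 0 1) = 1) (n : ℕ) (x : ℕ → State d)
    {m : Finset (Set (Pt d))} (hm : IsDyadicPartition m) {K : Set (Pt d)} (hK : K ∈ m)
    {u v : State d} (h : Sum.elim u v ∈ K) : pieceEst μ n x m u v = coef μ n x K := by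
  rw [pieceEst_eq hμ n x hm, Finset.sum_eq_single_of_mem K hK]
  · simp [ind, h]
  · intro K' hK' hne
    have : Sum.elim u v ∉ K' := fun h' => hne (hm.eq_of_mem _ hK' _ hK _ h' h)
    simp [ind, this]

lemma restr_pieceEst {μ : Measure (State d)} (hμ : μ (Icc 0 1) = 1) (n : ℕ) (x : ℕ → State d)
    {m : Finset (Set (Pt d))} (hm : IsDyadicPartition m) {K C : Set (Pt d)} (hK : K ∈ m)
    (hC : C ⊆ K) : restr (pieceEst μ n x m) C = fun u v => coef μ n x K * ind C u v := by
  funext u v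
  by_cases h : Sum.elim u v ∈ C
  · rw [restr, pieceEst_of_mem hμ n x hm hK (hC h)]
  · simp [restr, ind, h]

/-- The comparison of `ŝ_m'` with `ŝ_m` on the cell `K ∩ K'`. -/
lemma alpha_mul_hellSq_add_testT {μ : Measure (State d)} (hμ : μ (Icc 0 1) = 1) (n : ℕ)
    (x : ℕ → State d) {m m' : Finset (Set (Pt d))} (hm : IsDyadicPartition m)
    (hm' : IsDyadicPartition m') {K K' : Set (Pt d)} (hK : K ∈ m) (hK' : K' ∈ m') :
    alpha * hellSq μ n x (restr (pieceEst μ n x m) (K ∩ K')) (restr (pieceEst μ n x m') (K ∩ K')) +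
      testT μ n x (restr (pieceEst μ n x m) (K ∩ K')) (restr (pieceEst μ n x m') (K ∩ K')) =
      1 / n * cellTest (coef μ n x K) (coef μ n x K') ((occ μ n x).real (K ∩ K'))
        (hits n x (K ∩ K')) := by
  rw [restr_pieceEst hμ n x hm hK inter_subset_left,
    restr_pieceEst hμ n x hm' hK' inter_subset_right]
  exact alpha_mul_hellSq_add_testT_const hμ n x ((hm.measurableSet hK).inter
    (hm'.measurableSet hK')) (inter_subset_left.trans (hm.subset_Icc hK)) _ _

/-- Antisymmetry makes the test terms cancel when two histograms are compared in both directions. -/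
lemma testT_swap (μ : Measure (State d)) (n : ℕ) (x : ℕ → State d)
    (f g : State d → State d → ℝ) : testT μ n x g f = -testT μ n x f g := by
  have h1 : ∀ i, ∫ y, √(g (x i) y + f (x i) y) * (√(f (x i) y) - √(g (x i) y)) ∂μ =
      -∫ y, √(f (x i) y + g (x i) y) * (√(g (x i) y) - √(f (x i) y)) ∂μ := fun i => by
    rw [← integral_neg]
    congr 1
    funext y
    rw [add_comm (g (x i) y)]; ring
  have h2 : ∀ i, (√(f (x i) (x (i + 1))) - √(g (x i) (x (i + 1)))) /
        √(g (x i) (x (i + 1)) + f (x i) (x (i + 1))) =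
      -((√(g (x i) (x (i + 1))) - √(f (x i) (x (i + 1)))) /
        √(f (x i) (x (i + 1)) + g (x i) (x (i + 1)))) := fun i => by
    rw [add_comm (g (x i) (x (i + 1))), ← neg_div, neg_sub]
  have h3 : ∀ i, ∫ y, (g (x i) y - f (x i) y) ∂μ = -∫ y, (f (x i) y - g (x i) y) ∂μ :=
    fun i => by
      rw [← integral_neg]
      congr 1
      funext y
      ring
  unfold testT
  simp only [h1, h2, h3, Finset.sum_neg_distrib]
  ring

lemma hellSq_swap (μ : Measure (State d)) (n : ℕ) (x : ℕ → State d)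
    (f g : State d → State d → ℝ) : hellSq μ n x g f = hellSq μ n x f g := by
  unfold hellSq
  congr 1
  refine Finset.sum_congr rfl fun i _ => ?_
  congr 1
  funext y
  ring

/-- The sum of the comparisons of `ŝ_m'` with `ŝ_m` over the cells in `K`. -/
def compare (μ : Measure (State d)) (n : ℕ) (x : ℕ → State d) (m m' : Finset (Set (Pt d)))
    (K : Set (Pt d)) : ℝ :=
  ∑ K' ∈ m',
    (alpha * hellSq μ n x (restr (pieceEst μ n x m) (K ∩ K')) (restr (pieceEst μ n x m') (K ∩ K'))
      + testT μ n x (restr (pieceEst μ n x m) (K ∩ K')) (restr (pieceEst μ n x m') (K ∩ K')))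

/-- Deterministic: on each partition the hits sum to at most `n`, and value times mass never exceeds
hits. It makes the suprema in the criterion finite and handles partitions with many cells in `K`. -/
lemma compare_le_three {μ : Measure (State d)} (hμ : μ (Icc 0 1) = 1) {n : ℕ} (hn : 0 < n)
    (x : ℕ → State d) {m m' : Finset (Set (Pt d))} (hm : IsDyadicPartition m)
    (hm' : IsDyadicPartition m') {K : Set (Pt d)} (hK : K ∈ m) : compare μ n x m m' K ≤ 3 := by
  have := isFiniteMeasure_occ hμ n x
  have hn0 : (0 : ℝ) < n := by exact_mod_cast hn
  have hle : ∀ {A B : Set (Pt d)}, A ⊆ B → hits n x A ≤ hits n x B := fun h =>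
    Finset.sum_le_sum fun i _ => Set.indicator_le_indicator_of_subset h (fun _ => zero_le_one) _
  have h1 : ∑ K' ∈ m', cellTest (coef μ n x K) (coef μ n x K') ((occ μ n x).real (K ∩ K'))
      (hits n x (K ∩ K')) ≤ 3 * n := by
    calc _ ≤ ∑ K' ∈ m', (coef μ n x K * (occ μ n x).real (K ∩ K') + 2 * hits n x K') := by
          refine Finset.sum_le_sum fun K' hK' => ?_
          refine (cellTest_le_add (coef_nonneg _ _ _ _) (coef_nonneg _ _ _ _) measureReal_nonneg
            (hits_nonneg _ _ _)).trans ?_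
          have e1 : (occ μ n x).real (K ∩ K') ≤ (occ μ n x).real K' :=
            measureReal_mono inter_subset_right
          have e2 := mul_le_mul_of_nonneg_left e1 (coef_nonneg μ n x K')
          have e3 := coef_mul_le μ n x K'
          have e4 : hits n x (K ∩ K') ≤ hits n x K' := hle inter_subset_right
          linarith
      _ = coef μ n x K * (occ μ n x).real K + 2 * ∑ K' ∈ m', hits n x K' := by
          rw [Finset.sum_add_distrib, ← Finset.mul_sum, ← Finset.mul_sum,
            hm'.sum_measureReal_inter (hm.measurableSet hK) (hm.subset_Icc hK)]
      _ ≤ 3 * n := by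
          have e1 := coef_mul_le μ n x K
          have e2 := hm'.sum_hits_le n x
          have e3 : hits n x K ≤ ∑ K ∈ m, hits n x K :=
            Finset.single_le_sum (f := hits n x) (fun K _ => hits_nonneg n x K) hK
          have e4 := hm.sum_hits_le n x
          linarith
  unfold compare
  rw [Finset.sum_congr rfl fun K' hK' => alpha_mul_hellSq_add_testT hμ n x hm hm' hK hK',
    ← Finset.mul_sum, one_div, inv_mul_le_iff₀ hn0, mul_comm (n : ℝ)]
  exact h1

lemma pen_nonneg {L : ℝ} (hL : 0 ≤ L) (n : ℕ) (m : Finset (Set (Pt d))) : 0 ≤ pen L n m :=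
  mul_nonneg hL (div_nonneg (mul_nonneg (Nat.cast_nonneg _) (Real.log_natCast_nonneg n))
    (Nat.cast_nonneg _))

lemma one_le_log {n : ℕ} (hn : 3 < n) : 1 ≤ Real.log n := by
  have hn4 : (4 : ℝ) ≤ n := by exact_mod_cast hn
  rw [Real.le_log_iff_exp_le (by linarith)]
  linarith [Real.exp_one_lt_d9]

section Selection

variable {Ω : Type*} [MeasurableSpace Ω] {P : Measure Ω}
  {μ : Measure (State d)} {s : State d → State d → ℝ} {X : ℕ → Ω → State d}

namespace IsMarkovChainWithDensity

variable (hX : IsMarkovChainWithDensity P μ s X)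
include hX

lemma sum_cellLoss_inter (hμ : μ (Icc 0 1) = 1) (n : ℕ) (x : ℕ → State d) {a : ℝ} (ha : 0 ≤ a)
    {m' : Finset (Set (Pt d))} (hm' : IsDyadicPartition m') {K : Set (Pt d)}
    (hK : MeasurableSet K) (hKA : K ⊆ Icc 0 1) :
    ∑ K' ∈ m', cellLoss μ s n x a (K ∩ K') = cellLoss μ s n x a K :=
  hm'.sum_setIntegral_inter (hX.integrable_sq_sqrt_dens_sub hμ n x ha) hK hKA

/-- The loss of the histogram is the sum of the losses on the cells. -/
lemma hellSq_pieceEst (hμ : μ (Icc 0 1) = 1) (n : ℕ) (x : ℕ → State d)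
    {m : Finset (Set (Pt d))} (hm : IsDyadicPartition m) :
    hellSq μ n x (restr s (Icc 0 1)) (pieceEst μ n x m) =
      1 / (2 * n) * ∑ K ∈ m, cellLoss μ s n x (coef μ n x K) K := by
  have hpt : ∀ u v, (√(restr s (Icc 0 1) u v) - √(pieceEst μ n x m u v)) ^ 2 =
      ∑ K ∈ m, (√(dens s (Sum.elim u v)) - √(coef μ n x K)) ^ 2 * ind K u v := by
    intro u v
    by_cases h : Sum.elim u v ∈ Icc (0 : Pt d) 1
    · obtain ⟨K, hK, hv⟩ := hm.exists_mem _ h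
      rw [Finset.sum_eq_single_of_mem K hK, pieceEst_of_mem hμ n x hm hK hv, restr]
      · have h1 : ind (Icc 0 1) u v = 1 := Set.indicator_of_mem h _
        have h2 : ind K u v = 1 := Set.indicator_of_mem hv _
        rw [h1, h2, mul_one, mul_one, dens_sumElim]
      · intro K' hK' hne
        have : Sum.elim u v ∉ K' := fun h' => hne (hm.eq_of_mem _ hK' _ hK _ h' hv)
        simp [ind, this]
    · have h0 : ∀ K ∈ m, ind K u v = 0 := fun K hK =>
        Set.indicator_of_notMem (fun h' => h (hm.subset_Icc hK h')) _
      have h1 : ind (Icc 0 1) u v = 0 := Set.indicator_of_notMem h _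
      rw [pieceEst_eq hμ n x hm, restr, h1, Finset.sum_eq_zero fun K hK => by rw [h0 K hK, mul_zero],
        Finset.sum_eq_zero fun K hK => by rw [h0 K hK, mul_zero]]
      simp
  have hint : ∀ i, ∀ K ∈ m, Integrable (fun y => (√(dens s (Sum.elim (x i) y)) -
      √(coef μ n x K)) ^ 2 * ind K (x i) y) μ := by
    intro i K hK
    have hKm := hm.measurableSet hK
    have hKA := hm.subset_Icc hK
    have hindm : Measurable fun y => ind K (x i) y :=
      (measurable_ind hKm).comp (measurable_const.prodMk measurable_id)
    have hc : Integrable ((Icc (0 : State d) 1).indicator fun _ => coef μ n x K) μ :=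
      (integrable_indicator_iff measurableSet_Icc).2 (integrableOn_const (by simp [hμ]))
    refine (hc.add (hX.integrable_density (x i))).mono'
      (((((hX.measurable_density_right (x i)).sqrt.sub_const _).pow_const 2).mul
        hindm).aestronglyMeasurable) (Filter.Eventually.of_forall fun y => ?_)
    rw [Real.norm_of_nonneg (mul_nonneg (sq_nonneg _) (ind_nonneg _ _ _)), Pi.add_apply]
    by_cases hy : y ∈ Icc (0 : State d) 1
    · rw [Set.indicator_of_mem hy]
      exact (mul_le_of_le_one_right (sq_nonneg _) (ind_le_one _ _ _)).trans
        (hX.sq_sqrt_dens_sub_le (coef_nonneg _ _ _ _) _)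
    · rw [ind_eq_zero_of_notMem hKA hy, mul_zero, Set.indicator_of_notMem hy, zero_add]
      exact hX.nonneg _ _
  unfold hellSq
  congr 1
  simp only [hpt]
  rw [Finset.sum_congr rfl fun i _ => integral_finsetSum m (hint i), Finset.sum_comm]
  refine Finset.sum_congr rfl fun K hK => ?_
  exact sum_integral_mul_ind n x ((hX.measurable_dens.sqrt.sub_const _).pow_const 2)
    (hX.integrable_sq_sqrt_dens_sub hμ n x (coef_nonneg _ _ _ _)) (hm.measurableSet hK)
    (hm.subset_Icc hK)

/-- `(√s - √ŝ)² ≤ s + ŝ`, and each of the two has total mass at most `n`. This bound serves off the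
good event and when the rate exceeds one. -/
lemma hellSq_pieceEst_le_one (hμ : μ (Icc 0 1) = 1) {n : ℕ} (hn : 0 < n) (x : ℕ → State d)
    {m : Finset (Set (Pt d))} (hm : IsDyadicPartition m) :
    hellSq μ n x (restr s (Icc 0 1)) (pieceEst μ n x m) ≤ 1 := by
  have hn0 : (0 : ℝ) < n := by exact_mod_cast hn
  rw [hX.hellSq_pieceEst hμ n x hm]
  have hcomp : ∑ K ∈ m, compensator μ s n x K ≤ n := by
    unfold compensator
    rw [Finset.sum_comm]
    calc _ ≤ ∑ i ∈ Finset.range n, (1 : ℝ) := Finset.sum_le_sum fun i _ => ?_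
      _ = n := by simp
    unfold drift
    rw [← integral_finsetSum _ fun K hK => hX.integrable_restr (hm.measurableSet hK) _,
      ← hX.integral_density (x i)]
    refine integral_mono (integrable_finsetSum _ fun K hK =>
      hX.integrable_restr (hm.measurableSet hK) _) (hX.integrable_density _) fun v => ?_
    simp only [restr]
    rw [← Finset.mul_sum]
    exact mul_le_of_le_one_right (hX.nonneg _ v) (hm.sum_ind_le_one _ v)
  have h : ∑ K ∈ m, cellLoss μ s n x (coef μ n x K) K ≤ 2 * n := by
    calc _ ≤ ∑ K ∈ m, (hits n x K + compensator μ s n x K) := by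
          refine Finset.sum_le_sum fun K hK => ?_
          refine (hX.cellLoss_le hμ n x (coef_nonneg _ _ _ _) (hm.measurableSet hK)
            (hm.subset_Icc hK)).trans ?_
          linarith [coef_mul_le μ n x K]
      _ ≤ 2 * n := by
          rw [Finset.sum_add_distrib]; linarith [hm.sum_hits_le n x]
  rw [one_div, inv_mul_le_iff₀ (by positivity)]
  linarith

/-- On a cell of level at most `n`, no histogram is preferred to `ŝ_m` by more than the loss of
`ŝ_m` and the penalty. -/
lemma compare_le (hd : 1 ≤ d) (hμ : μ (Icc 0 1) = 1) {n : ℕ} (hn : 3 < n) {x : ℕ → State d}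
    (hconc : Concentrated μ s n x) {L : ℝ} (hL : 800 ≤ L) {m m' : Finset (Set (Pt d))}
    (hm : IsDyadicPartition m) (hm' : IsDyadicPartition m') {j : ℕ} (hj : j ≤ n)
    {K : Set (Pt d)} (hK : K ∈ m) (hKj : K ∈ regular d j) :
    compare μ n x m m' K ≤
      3 / (2 * n) * cellLoss μ s n x (coef μ n x K) K + pen L n (vee m' K) := by
  classical
  have hn0 : (0 : ℝ) < n := by positivity
  have hlog := one_le_log hn
  have hKm := hm.measurableSet hK
  have hKA := hm.subset_Icc hK
  -- With at least `n` cells in `K` the penalty is at least `L ≥ 3`. With fewer, the cells of `m'`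
  -- that meet `K` have level at most `j + n ≤ 2n`, where the concentration is available.
  rcases le_or_gt n (vee m' K).card with hcard | hcard
  · have h3 : (3 : ℝ) ≤ pen L n (vee m' K) := by
      have e : (1 : ℝ) ≤ ((vee m' K).card : ℝ) * Real.log n / n := by
        rw [le_div_iff₀ hn0, one_mul]
        have : (n : ℝ) ≤ (vee m' K).card := by exact_mod_cast hcard
        nlinarith
      unfold pen
      nlinarith
    have := compare_le_three hμ (by omega : 0 < n) x hm hm' hK
    have := mul_nonneg (show (0 : ℝ) ≤ 3 / (2 * n) by positivity)
      (cellLoss_nonneg (μ := μ) (s := s) n x (coef μ n x K) K)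
    linarith
  · have hcell : ∀ K' ∈ m', cellTest (coef μ n x K) (coef μ n x K') ((occ μ n x).real (K ∩ K'))
        (hits n x (K ∩ K')) ≤ 3 / 2 * cellLoss μ s n x (coef μ n x K) (K ∩ K') +
          if (K ∩ K').Nonempty then 800 * Real.log n else 0 := by
      intro K' hK'
      split_ifs with hne
      · obtain ⟨v, hv, hv'⟩ := hne
        have hvA := hKA hv
        obtain ⟨z, hz, hKz⟩ := mem_regular.1 hKj
        obtain ⟨k, w, hw, hKw⟩ := hm'.exists_cell K' hK'
        obtain rfl : K = cell j v := by rw [hKz] at hv ⊢; exact (cell_eq_of_mem hv).symm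
        obtain rfl : K' = cell k v := by rw [hKw] at hv' ⊢; exact (cell_eq_of_mem hv').symm
        have hk := level_le_add_card_vee hd hm' (i := j) hvA hK'
        have hreg : ∃ l ≤ 2 * n, cell j v ∩ cell k v ∈ regular d l := by
          rcases le_total j k with hjk | hjk
          · refine ⟨k, by omega, ?_⟩
            rw [inter_eq_right.2 (cell_anti v hjk)]
            exact mem_regular.2 ⟨v, hvA, rfl⟩
          · refine ⟨j, by omega, ?_⟩
            rw [inter_eq_left.2 (cell_anti v hjk)]
            exact mem_regular.2 ⟨v, hvA, rfl⟩
        obtain ⟨l, hl, hreg⟩ := hreg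
        refine (hX.cellTest_le hμ x (coef_nonneg _ _ _ _) (coef_nonneg _ _ _ _)
          (u := 8 * Real.log n) (by linarith)
          ((measurableSet_cell _ _).inter (measurableSet_cell _ _))
          (inter_subset_left.trans (cell_subset_Icc _ _)) (hconc l hl _ hreg)).trans (le_of_eq ?_)
        ring
      · rw [not_nonempty_iff_eq_empty.1 hne]
        have e1 : hits n x (∅ : Set (Pt d)) = 0 := by simp [hits, ind]
        simp [cellTest, e1, cellLoss]
    unfold compare
    rw [Finset.sum_congr rfl fun K' hK' => alpha_mul_hellSq_add_testT hμ n x hm hm' hK hK',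
      ← Finset.mul_sum]
    have hsum := Finset.sum_le_sum hcell
    rw [Finset.sum_add_distrib, ← Finset.mul_sum,
      hX.sum_cellLoss_inter hμ n x (coef_nonneg _ _ _ _) hm' hKm hKA, ← Finset.sum_filter,
      Finset.sum_const, nsmul_eq_mul, ← card_vee hm' K] at hsum
    have hmul := mul_le_mul_of_nonneg_left hsum (show (0 : ℝ) ≤ 1 / n by positivity)
    refine hmul.trans ?_
    have e1 : (1 / n : ℝ) * (3 / 2 * cellLoss μ s n x (coef μ n x K) K +
        (vee m' K).card * (800 * Real.log n)) = 3 / (2 * n) * cellLoss μ s n x (coef μ n x K) K +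
          800 * ((vee m' K).card * Real.log n / n) := by
      field_simp
    rw [e1]
    unfold pen
    gcongr

end IsMarkovChainWithDensity

end Selection

end

section

variable {d : ℕ}

/-! ### Selection among the histograms -/

section Selection

variable {Ω : Type*} [MeasurableSpace Ω] {P : Measure Ω}
  {μ : Measure (State d)} {s : State d → State d → ℝ} {X : ℕ → Ω → State d}

lemma crit_eq (μ : Measure (State d)) (n : ℕ) (L : ℝ) (𝓜 : Set (Finset (Set (Pt d))))
    (x : ℕ → State d) (m : Finset (Set (Pt d))) :
    crit μ n L 𝓜 x m = ∑ K ∈ m, (⨆ m' : 𝓜, (compare μ n x m m'.1 K - pen L n (vee m'.1 K))) +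
      2 * pen L n m := rfl

lemma sum_pen_vee_le {L : ℝ} (hL : 0 ≤ L) (n : ℕ) {m m' : Finset (Set (Pt d))}
    (hm : IsDyadicPartition m) (hm' : IsDyadicPartition m') :
    ∑ K ∈ m, pen L n (vee m' K) ≤ pen L n m + pen L n m' := by
  have h : (∑ K ∈ m, ((vee m' K).card : ℝ)) ≤ m.card + m'.card := by
    exact_mod_cast sum_card_vee_le hm hm'
  have h0 : 0 ≤ L * (Real.log n / n) :=
    mul_nonneg hL (div_nonneg (Real.log_natCast_nonneg n) (Nat.cast_nonneg _))
  have e : ∀ m : Finset (Set (Pt d)), pen L n m = L * (Real.log n / n) * m.card := fun m => by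
    unfold pen; ring
  simp only [e]
  rw [← Finset.mul_sum, ← mul_add]
  exact mul_le_mul_of_nonneg_left h h0

/-- A real supremum bounds its terms only if the family is bounded above; `compare_le_three`
provides this. -/
lemma crit_ge (hd : 1 ≤ d) (hμ : μ (Icc 0 1) = 1) {n : ℕ} (hn : 0 < n) (x : ℕ → State d) {L : ℝ}
    (hL : 0 ≤ L) {m m' : Finset (Set (Pt d))} (hm : m ∈ allPartitions d)
    (hm' : m' ∈ allPartitions d) :
    ∑ K ∈ m, (compare μ n x m m' K - pen L n (vee m' K)) + 2 * pen L n m ≤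
      crit μ n L (allPartitions d) x m := by
  rw [crit_eq]
  refine add_le_add (Finset.sum_le_sum fun K hK => ?_) le_rfl
  refine le_ciSup (f := fun m' : allPartitions d =>
    compare μ n x m m'.1 K - pen L n (vee m'.1 K)) ?_ ⟨m', hm'⟩
  refine ⟨3, ?_⟩
  rintro _ ⟨m'', rfl⟩
  have h1 := compare_le_three hμ hn x (isDyadicPartition_of_mem hd hm)
    (isDyadicPartition_of_mem hd m''.2) hK
  have h2 := pen_nonneg hL n (vee m''.1 K)
  simp only
  linarith

/-- The tests cancel, and the two Hellinger terms add up to `2α` times the squared distance between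
the histograms. -/
lemma sum_compare_add_sum_compare (hμ : μ (Icc 0 1) = 1) (n : ℕ) (x : ℕ → State d)
    {m m' : Finset (Set (Pt d))} (hm : IsDyadicPartition m) (hm' : IsDyadicPartition m') :
    ∑ K ∈ m, compare μ n x m m' K + ∑ K' ∈ m', compare μ n x m' m K' =
      2 * alpha * ∑ K ∈ m, ∑ K' ∈ m',
        1 / n * ((occ μ n x).real (K ∩ K') * (√(coef μ n x K) - √(coef μ n x K')) ^ 2 / 2) := by
  unfold compare
  rw [Finset.sum_comm (s := m') (t := m), ← Finset.sum_add_distrib, Finset.mul_sum]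
  refine Finset.sum_congr rfl fun K hK => ?_
  rw [← Finset.sum_add_distrib, Finset.mul_sum]
  refine Finset.sum_congr rfl fun K' hK' => ?_
  have hc : K' ∩ K = K ∩ K' := inter_comm _ _
  rw [hc, testT_swap _ _ _ (restr (pieceEst μ n x m) (K ∩ K')),
    hellSq_swap _ _ _ (restr (pieceEst μ n x m) (K ∩ K')),
    restr_pieceEst hμ n x hm hK inter_subset_left,
    restr_pieceEst hμ n x hm' hK' inter_subset_right,
    hellSq_const hμ n x ((hm.measurableSet hK).inter (hm'.measurableSet hK'))
      (inter_subset_left.trans (hm.subset_Icc hK))]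
  ring

namespace IsMarkovChainWithDensity

variable (hX : IsMarkovChainWithDensity P μ s X)
include hX

lemma hellSq_pieceEst_triangle (hμ : μ (Icc 0 1) = 1) (n : ℕ) (x : ℕ → State d)
    {m m' : Finset (Set (Pt d))} (hm : IsDyadicPartition m) (hm' : IsDyadicPartition m') :
    hellSq μ n x (restr s (Icc 0 1)) (pieceEst μ n x m) ≤
      2 * hellSq μ n x (restr s (Icc 0 1)) (pieceEst μ n x m') + 2 * ∑ K ∈ m, ∑ K' ∈ m',
        1 / n * ((occ μ n x).real (K ∩ K') * (√(coef μ n x K) - √(coef μ n x K')) ^ 2 / 2) := by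
  rw [hX.hellSq_pieceEst hμ n x hm, hX.hellSq_pieceEst hμ n x hm']
  have h1 : ∑ K ∈ m, cellLoss μ s n x (coef μ n x K) K =
      ∑ K ∈ m, ∑ K' ∈ m', cellLoss μ s n x (coef μ n x K) (K ∩ K') :=
    Finset.sum_congr rfl fun K hK => (hX.sum_cellLoss_inter hμ n x (coef_nonneg _ _ _ _) hm'
      (hm.measurableSet hK) (hm.subset_Icc hK)).symm
  have h2 : ∑ K' ∈ m', cellLoss μ s n x (coef μ n x K') K' =
      ∑ K ∈ m, ∑ K' ∈ m', cellLoss μ s n x (coef μ n x K') (K ∩ K') := by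
    rw [Finset.sum_comm]
    refine Finset.sum_congr rfl fun K' hK' => ?_
    rw [← hX.sum_cellLoss_inter hμ n x (coef_nonneg _ _ _ _) hm
      (hm'.measurableSet hK') (hm'.subset_Icc hK')]
    exact Finset.sum_congr rfl fun K _ => by rw [inter_comm]
  rw [h1, h2]
  simp only [Finset.mul_sum]
  rw [← Finset.sum_add_distrib]
  refine Finset.sum_le_sum fun K _ => ?_
  rw [← Finset.sum_add_distrib]
  refine Finset.sum_le_sum fun K' _ => ?_
  have h3 := mul_le_mul_of_nonneg_left (hX.cellLoss_triangle hμ n x (coef_nonneg μ n x K)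
    (coef_nonneg μ n x K') (K ∩ K')) (show (0 : ℝ) ≤ 1 / (2 * n) by positivity)
  refine h3.trans (le_of_eq ?_)
  rw [one_div, one_div, mul_inv]
  ring

/-- The selected histogram is nearly as good as any regular one. -/
lemma hellSq_selected_le (hd : 1 ≤ d) (hμ : μ (Icc 0 1) = 1) {n : ℕ} (hn : 3 < n)
    {x : ℕ → State d} (hconc : Concentrated μ s n x) {L : ℝ} (hL : 800 ≤ L)
    {mhat : Finset (Set (Pt d))} (hsel : IsSelected μ n L (allPartitions d) x mhat) {j : ℕ}
    (hj : j ≤ n) :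
    hellSq μ n x (restr s (Icc 0 1)) (pieceEst μ n x mhat) ≤
      50 * hellSq μ n x (restr s (Icc 0 1)) (pieceEst μ n x (regular d j)) +
        32 * pen L n (regular d j) + 8 * (1 / n) := by
  have hn0 : 0 < n := by omega
  have hL0 : 0 ≤ L := by linarith
  set m := regular d j with hmdef
  have hmem := regular_mem_allPartitions hd j
  have hm : IsDyadicPartition m := isDyadicPartition_of_mem hd hmem
  have hmh : IsDyadicPartition mhat := isDyadicPartition_of_mem hd hsel.1
  have hcomp : ∀ m' : Finset (Set (Pt d)), IsDyadicPartition m' → ∀ K ∈ m,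
      compare μ n x m m' K ≤
        3 / (2 * n) * cellLoss μ s n x (coef μ n x K) K + pen L n (vee m' K) :=
    fun m' hm' K hK => hX.compare_le hd hμ hn hconc hL hm hm' hj hK hK
  have hHm := hX.hellSq_pieceEst hμ n x hm
  have hsumloss : ∑ K ∈ m, 3 / (2 * n) * cellLoss μ s n x (coef μ n x K) K =
      3 * hellSq μ n x (restr s (Icc 0 1)) (pieceEst μ n x m) := by
    rw [hHm, ← Finset.mul_sum]; ring
  have hcrit : crit μ n L (allPartitions d) x m ≤
      3 * hellSq μ n x (restr s (Icc 0 1)) (pieceEst μ n x m) + 2 * pen L n m := by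
    rw [crit_eq, ← hsumloss]
    refine add_le_add (Finset.sum_le_sum fun K hK => ?_) le_rfl
    have : Nonempty (allPartitions d) := ⟨⟨m, hmem⟩⟩
    refine ciSup_le fun m' => ?_
    linarith [hcomp m'.1 (isDyadicPartition_of_mem hd m'.2) K hK]
  have hge := crit_ge hd hμ hn0 x hL0 hsel.1 hmem
  have hle := hsel.2 m hmem
  have hswap := sum_compare_add_sum_compare hμ n x hmh hm
  have hback : ∑ K ∈ m, compare μ n x m mhat K ≤
      3 * hellSq μ n x (restr s (Icc 0 1)) (pieceEst μ n x m) +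
        ∑ K ∈ m, pen L n (vee mhat K) := by
    rw [← hsumloss, ← Finset.sum_add_distrib]
    exact Finset.sum_le_sum fun K hK => hcomp mhat hmh K hK
  -- Together the two overlays cost `2 pen m + 2 pen mhat`; the last part is cancelled by the term
  -- `2 pen mhat` of the criterion.
  have hp1 := sum_pen_vee_le hL0 n hmh hm
  have hp2 := sum_pen_vee_le hL0 n hm hmh
  have htri := hX.hellSq_pieceEst_triangle hμ n x hmh hm
  rw [Finset.sum_sub_distrib] at hge
  set h := ∑ K ∈ mhat, ∑ K' ∈ m,
    1 / n * ((occ μ n x).real (K ∩ K') * (√(coef μ n x K) - √(coef μ n x K')) ^ 2 / 2)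
  have hh0 : 0 ≤ h := Finset.sum_nonneg fun K _ => Finset.sum_nonneg fun K' _ => by positivity
  -- Now `2αh ≤ 6H² + 4 pen m + 1/n`, where `H²` is the loss of the regular histogram. As `2α ≥
  -- 1/4`, `h ≤ 24H² + 16 pen m + 4/n`, and the triangle inequality gives the constants `50`, `32`,
  -- `8`.
  have halpha := mul_le_mul_of_nonneg_right alpha_bounds.1.le hh0
  linarith

/-! ### Loss of the regular histograms -/

/-- The loss of the estimator on a cell where the square root of the density oscillates little. -/
lemma cellLoss_coef_le (hμ : μ (Icc 0 1) = 1) {n : ℕ} (hn : 3 < n) {x : ℕ → State d}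
    {K : Set (Pt d)} (hK : MeasurableSet K) (hKA : K ⊆ Icc 0 1)
    (hconc : ∀ l : ℝ, 0 < l → l ≤ 1 → |hits n x K - compensator μ s n x K| ≤
      l * compensator μ s n x K + 2 * (8 * Real.log n) / l)
    {δ : ℝ} (hδ : ∀ z ∈ K, ∀ w ∈ K, |√(dens s z) - √(dens s w)| ≤ δ) :
    cellLoss μ s n x (coef μ n x K) K ≤
      2 * ((occ μ n x).real K * δ ^ 2) + 144 * Real.log n := by
  have := isFiniteMeasure_occ hμ n x
  have hlog := one_le_log hn
  set M := (occ μ n x).real K with hM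
  set V := compensator μ s n x K with hV
  have hV0 : 0 ≤ V := hX.compensator_nonneg n x K
  have hMnn : 0 ≤ M := measureReal_nonneg
  rcases hMnn.eq_or_lt with hM0 | hM0
  · have hz : occ μ n x K = 0 := by
      rwa [eq_comm, hM, measureReal_eq_zero_iff] at hM0
    rw [cellLoss, setIntegral_measure_zero _ hz, ← hM0]
    linarith
  have hVeq := hX.compensator_eq n x hK hKA
  have hmono : ∀ c : ℝ, (∀ w ∈ K, dens s w ≤ c) → V ≤ M * c := by
    intro c hc
    rw [hV, hVeq]
    refine (setIntegral_mono_on (hX.integrable_dens n x).integrableOn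
      (integrable_const c).integrableOn hK hc).trans (le_of_eq ?_)
    simp [hM]
  have hmono' : ∀ c : ℝ, (∀ w ∈ K, c ≤ dens s w) → M * c ≤ V := by
    intro c hc
    rw [hV, hVeq]
    refine le_trans (le_of_eq ?_) (setIntegral_mono_on (integrable_const c).integrableOn
      (hX.integrable_dens n x).integrableOn hK hc)
    simp [hM]
  -- `V / M` is the mean of the density over the cell, so its root is within the oscillation `δ` of
  -- every value of the root.
  have hbias : ∀ z ∈ K, (√(dens s z) - √(V / M)) ^ 2 ≤ δ ^ 2 := by
    intro z hz
    have hδ0 : 0 ≤ δ := (abs_nonneg _).trans (hδ z hz z hz)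
    have h1 : √(V / M) ≤ √(dens s z) + δ := by
      refine Real.sqrt_le_left (by positivity) |>.2 ?_
      rw [div_le_iff₀ hM0, mul_comm]
      refine hmono _ fun w hw => ?_
      rw [← Real.sq_sqrt (hX.dens_nonneg w)]
      have := (abs_le.1 (hδ z hz w hw)).1
      exact pow_le_pow_left₀ (Real.sqrt_nonneg _) (by linarith) 2
    have h2 : √(dens s z) - δ ≤ √(V / M) := by
      rcases le_or_gt (√(dens s z) - δ) 0 with h | h
      · exact h.trans (Real.sqrt_nonneg _)
      · refine Real.le_sqrt_of_sq_le ?_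
        rw [le_div_iff₀ hM0, mul_comm]
        refine hmono' _ fun w hw => ?_
        rw [← Real.sq_sqrt (hX.dens_nonneg w)]
        have := (abs_le.1 (hδ z hz w hw)).2
        exact pow_le_pow_left₀ h.le (by linarith) 2
    rw [sq_le_sq, abs_of_nonneg hδ0, abs_le]
    constructor <;> linarith
  have hVM : 0 ≤ V / M := div_nonneg hV0 hM0.le
  have hloss : cellLoss μ s n x (V / M) K ≤ M * δ ^ 2 := by
    refine (setIntegral_mono_on (hX.integrable_sq_sqrt_dens_sub hμ n x hVM).integrableOn
      (integrable_const (δ ^ 2)).integrableOn hK hbias).trans (le_of_eq ?_)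
    simp [hM]
  have hvar : M * (√(coef μ n x K) - √(V / M)) ^ 2 ≤ 9 * (8 * Real.log n) := by
    have h := sq_sqrt_sub_sqrt_le (hits_nonneg n x K) hV0
      (show 0 < 8 * Real.log n by linarith) hconc
    have hs : √M ^ 2 = M := Real.sq_sqrt hM0.le
    rw [coef, Real.sqrt_div' _ hM0.le, Real.sqrt_div' _ hM0.le, ← sub_div, div_pow, hs]
    rwa [mul_div_cancel₀ _ hM0.ne']
  have := hX.cellLoss_triangle hμ n x (coef_nonneg μ n x K) hVM K
  linarith

lemma hellSq_regular_le (hd : 1 ≤ d) (hμ : μ (Icc 0 1) = 1) {n : ℕ} (hn : 3 < n)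
    {x : ℕ → State d} (hconc : Concentrated μ s n x) {j : ℕ} (hj : j ≤ n) {δ : ℝ}
    (hδ : ∀ K ∈ regular d j, ∀ z ∈ K, ∀ w ∈ K, |√(dens s z) - √(dens s w)| ≤ δ) :
    hellSq μ n x (restr s (Icc 0 1)) (pieceEst μ n x (regular d j)) ≤
      δ ^ 2 + 72 * ((regular d j).card * (Real.log n / n)) := by
  have := isFiniteMeasure_occ hμ n x
  have hn0 : (0 : ℝ) < n := by positivity
  have hm := isDyadicPartition_regular hd j
  have hmass : ∑ K ∈ regular d j, (occ μ n x).real K ≤ n := by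
    have h := hm.sum_measureReal_inter (ν := occ μ n x) (K := Icc 0 1) measurableSet_Icc subset_rfl
    have h' : ∑ K ∈ regular d j, (occ μ n x).real K =
        ∑ K ∈ regular d j, (occ μ n x).real (Icc 0 1 ∩ K) :=
      Finset.sum_congr rfl fun K hK => by rw [inter_eq_right.2 (hm.subset_Icc hK)]
    rw [h', h]
    exact occ_real_le hμ n x _
  rw [hX.hellSq_pieceEst hμ n x hm]
  have hsum : ∑ K ∈ regular d j, cellLoss μ s n x (coef μ n x K) K ≤
      2 * (n * δ ^ 2) + (regular d j).card * (144 * Real.log n) := by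
    calc _ ≤ ∑ K ∈ regular d j, (2 * ((occ μ n x).real K * δ ^ 2) + 144 * Real.log n) :=
          Finset.sum_le_sum fun K hK => hX.cellLoss_coef_le hμ hn (hm.measurableSet hK)
            (hm.subset_Icc hK) (hconc j (by omega) K hK) (hδ K hK)
      _ = 2 * ((∑ K ∈ regular d j, (occ μ n x).real K) * δ ^ 2) +
          (regular d j).card * (144 * Real.log n) := by
          rw [Finset.sum_add_distrib, ← Finset.mul_sum, ← Finset.sum_mul, Finset.sum_const,
            nsmul_eq_mul]
      _ ≤ _ := by gcongr
  calc _ ≤ 1 / (2 * n) * (2 * (n * δ ^ 2) + (regular d j).card * (144 * Real.log n)) := by gcongr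
    _ = _ := by field_simp; ring

end IsMarkovChainWithDensity

end Selection

/-! ### Hölder functions -/

lemma abs_sub_le_of_code_eq {j : ℕ} {a b : ℝ} (ha : a ∈ Icc (0 : ℝ) 1) (hb : b ∈ Icc (0 : ℝ) 1)
    (h : code j a = code j b) : |a - b| ≤ 1 / 2 ^ j := by
  have hp : (0 : ℝ) < 2 ^ j := by positivity
  have key : ∀ t ∈ Icc (0 : ℝ) 1, (code j t : ℝ) ≤ 2 ^ j * t ∧ 2 ^ j * t ≤ code j t + 1 := by
    intro t ht
    have ht0 : 0 ≤ 2 ^ j * t := mul_nonneg hp.le ht.1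
    have h1 := Nat.floor_le ht0
    have h2 := Nat.lt_floor_add_one (2 ^ j * t)
    have h3 : 2 ^ j * t ≤ 2 ^ j := mul_le_of_le_one_right hp.le ht.2
    have hle : code j t ≤ ⌊2 ^ j * t⌋₊ := min_le_left _ _
    refine ⟨le_trans (by exact_mod_cast hle) h1, ?_⟩
    rcases min_choice ⌊2 ^ j * t⌋₊ (2 ^ j - 1) with hc | hc
    · rw [code, hc]; exact h2.le
    · rw [code, hc, Nat.cast_sub Nat.one_le_two_pow]
      push_cast
      linarith
  have h1 := key a ha
  have h2 := key b hb
  rw [h] at h1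
  rw [le_div_iff₀ hp, ← abs_of_pos hp, ← abs_mul, abs_le]
  constructor <;> nlinarith

/-- The `2d` coordinates are changed one at a time; the intermediate points stay in the unit cube.
-/
lemma HolderOnCube.abs_sub_le_of_mem_cell {σ R : ℝ} {f : Pt d → ℝ} (hσ : 0 < σ) (hR : 0 ≤ R)
    (hf : HolderOnCube σ R f) {j : ℕ} {v z w : Pt d} (hz : z ∈ cell j v) (hw : w ∈ cell j v) :
    |f z - f w| ≤ 2 * (d * R) * (1 / 2 ^ j) ^ σ := by
  classical
  have hstep : ∀ T : Finset (Fin d ⊕ Fin d),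
      |f (T.piecewise z w) - f w| ≤ T.card * (R * (1 / 2 ^ j) ^ σ) := by
    intro T
    induction T using Finset.induction_on with
    | empty => simp
    | insert i T hi ih =>
      have hmem : T.piecewise z w ∈ Icc (0 : Pt d) 1 := by
        constructor <;> intro k <;> by_cases hk : k ∈ T <;> simp only [Finset.piecewise, hk,
          if_true, if_false]
        exacts [hz.1.1 k, hw.1.1 k, hz.1.2 k, hw.1.2 k]
      have h := hf _ hmem i (z i) ⟨hz.1.1 i, hz.1.2 i⟩ (w i) ⟨hw.1.1 i, hw.1.2 i⟩
      have e1 : Function.update (T.piecewise z w) i (z i) = (insert i T).piecewise z w :=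
        (Finset.piecewise_insert T z w i).symm
      have e2 : Function.update (T.piecewise z w) i (w i) = T.piecewise z w := by
        rw [Function.update_eq_self_iff, Finset.piecewise_eq_of_notMem _ _ _ hi]
      rw [e1, e2] at h
      have h' : R * |z i - w i| ^ σ ≤ R * (1 / 2 ^ j) ^ σ := by
        refine mul_le_mul_of_nonneg_left (Real.rpow_le_rpow (abs_nonneg _) ?_ hσ.le) hR
        refine abs_sub_le_of_code_eq ⟨hz.1.1 i, hz.1.2 i⟩ ⟨hw.1.1 i, hw.1.2 i⟩ ?_
        rw [hz.2 i, hw.2 i]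
      rw [Finset.card_insert_of_notMem hi]
      push_cast
      have := abs_sub_le (f ((insert i T).piecewise z w)) (f (T.piecewise z w)) (f w)
      linarith
  have h := hstep Finset.univ
  rw [Finset.piecewise_univ] at h
  refine h.trans (le_of_eq ?_)
  simp only [Finset.card_univ, Fintype.card_sum, Fintype.card_fin]
  push_cast
  ring

/-! ### Choice of the level -/

/-- A level that balances the approximation error and the penalty. -/
lemma exists_level {d : ℕ} (hd : 1 ≤ d) {σ B ρ : ℝ} (hσ : 0 < σ) (hσ1 : σ ≤ 1) (hB : 0 ≤ B)
    (hρ : 0 < ρ) : ∃ j : ℕ,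
      B ^ 2 * ((1 / 2 ^ j : ℝ) ^ σ) ^ 2 ≤
        4 * (B ^ (2 * d / (d + σ)) * ρ ^ (σ / (σ + d)) + ρ) ∧
      (4 : ℝ) ^ (d * j) * ρ ≤ B ^ (2 * d / (d + σ)) * ρ ^ (σ / (σ + d)) + ρ := by
  have hd0 : (0 : ℝ) < d := by exact_mod_cast hd
  have hT0 : 0 ≤ B ^ (2 * d / (d + σ)) * ρ ^ (σ / (σ + d)) := by positivity
  rcases le_or_gt (B ^ 2) ρ with hBρ | hBρ
  · refine ⟨0, ?_, ?_⟩
    · simp; nlinarith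
    · simp; exact hT0
  have hB0 : 0 < B := lt_of_le_of_ne hB fun h => by rw [← h] at hBρ; norm_num at hBρ; linarith
  -- The real side ratio that balances the two terms: `B² x^(-2σ) = ρ x^(2d)`, and both equal the
  -- target rate. Rounding `x` down to a power of two loses a factor at most `2^(2σ) ≤ 4` in the
  -- bias and nothing in the penalty.
  set x : ℝ := (B ^ 2 / ρ) ^ (1 / (2 * (σ + d))) with hx
  have hq1 : 1 ≤ B ^ 2 / ρ := by rw [one_le_div hρ]; exact hBρ.le
  have hx1 : 1 ≤ x := Real.one_le_rpow hq1 (by positivity)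
  have hx0 : 0 < x := by linarith
  have hxp : x ^ (2 * (σ + d)) = B ^ 2 / ρ := by
    rw [hx, ← Real.rpow_mul (by positivity), one_div_mul_cancel (by positivity), Real.rpow_one]
  have hBx : B ^ 2 = ρ * (x ^ (2 * σ) * x ^ (2 * (d : ℝ))) := by
    rw [← Real.rpow_add hx0, ← mul_add, hxp]; field_simp
  have hT : B ^ (2 * d / (d + σ)) * ρ ^ (σ / (σ + d)) = ρ * x ^ (2 * (d : ℝ)) := by
    have h1 : B ^ (2 * d / (d + σ)) = (B ^ 2) ^ (d / (d + σ)) := by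
      rw [← Real.rpow_natCast B 2, ← Real.rpow_mul hB]
      congr 1
      push_cast
      ring
    have h2 : B ^ 2 = ρ * x ^ (2 * (σ + d)) := by rw [hxp]; field_simp
    rw [h1, h2, Real.mul_rpow hρ.le (by positivity), ← Real.rpow_mul hx0.le]
    have h3 : 2 * (σ + d) * (d / (d + σ)) = 2 * (d : ℝ) := by field_simp; ring
    have h4 : (d : ℝ) / (d + σ) + σ / (σ + d) = 1 := by rw [add_comm σ]; field_simp
    rw [h3, mul_right_comm, ← Real.rpow_add hρ, h4, Real.rpow_one]
  obtain ⟨j, hj1, hj2⟩ := exists_nat_pow_near hx1 (one_lt_two (α := ℝ))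
  have hp : (0 : ℝ) < 2 ^ j := by positivity
  refine ⟨j, ?_, ?_⟩
  · rw [hT]
    have h1 : (1 / 2 ^ j : ℝ) ≤ 2 / x := by
      rw [div_le_div_iff₀ hp hx0]; rw [pow_succ] at hj2; linarith
    have h2 : ((1 / 2 ^ j : ℝ) ^ σ) ≤ 2 * (x ^ σ)⁻¹ := by
      refine (Real.rpow_le_rpow (by positivity) h1 hσ.le).trans ?_
      rw [Real.div_rpow zero_le_two hx0.le, div_eq_mul_inv]
      gcongr
      calc (2 : ℝ) ^ σ ≤ 2 ^ (1 : ℝ) := Real.rpow_le_rpow_of_exponent_le one_le_two hσ1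
        _ = 2 := Real.rpow_one 2
    have h3 : ((1 / 2 ^ j : ℝ) ^ σ) ^ 2 ≤ 4 * (x ^ (2 * σ))⁻¹ := by
      calc _ ≤ (2 * (x ^ σ)⁻¹) ^ 2 := by gcongr
        _ = 4 * (x ^ (2 * σ))⁻¹ := by
          rw [mul_comm 2 σ, Real.rpow_mul hx0.le, Real.rpow_ofNat, mul_pow, inv_pow]; norm_num
    have hxs : 0 < x ^ (2 * σ) := by positivity
    calc B ^ 2 * ((1 / 2 ^ j : ℝ) ^ σ) ^ 2 ≤ B ^ 2 * (4 * (x ^ (2 * σ))⁻¹) := by gcongr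
      _ = 4 * (ρ * x ^ (2 * (d : ℝ))) := by rw [hBx]; field_simp
      _ ≤ _ := by linarith
  · rw [hT]
    have : (4 : ℝ) ^ (d * j) ≤ x ^ (2 * (d : ℝ)) := by
      calc (4 : ℝ) ^ (d * j) = ((2 : ℝ) ^ j) ^ (2 * d) := by
            rw [← pow_mul, show (4 : ℝ) = 2 ^ 2 by norm_num, ← pow_mul]; congr 1; ring
        _ ≤ x ^ (2 * d) := by gcongr
        _ = x ^ (2 * (d : ℝ)) := by rw [← Real.rpow_natCast]; push_cast; rfl
    nlinarith

end

section

variable {d : ℕ} {Ω : Type*} [MeasurableSpace Ω] {P : Measure Ω}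
  {μ : Measure (State d)} {s : State d → State d → ℝ} {X : ℕ → Ω → State d}

namespace IsMarkovChainWithDensity

variable (hX : IsMarkovChainWithDensity P μ s X)
include hX

/-! ### The risk of the selected histogram -/

lemma measurable_hellSq_pieceEst (hμ : μ (Icc 0 1) = 1) (n : ℕ) {m : Finset (Set (Pt d))}
    (hm : IsDyadicPartition m) :
    Measurable fun ω => hellSq μ n (fun i => X i ω) (restr s (Icc 0 1))
      (pieceEst μ n (fun i => X i ω) m) := by
  have := isProbabilityMeasure_restrict hμ
  have hind : ∀ i, ∀ K ∈ m, Measurable fun p : Ω × State d => ind K (X i p.1) p.2 :=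
    fun i K hK => (measurable_ind (hm.measurableSet hK)).comp
      (((hX.measurable_chain i).comp measurable_fst).prodMk measurable_snd)
  have hden : ∀ i, ∀ K ∈ m, Measurable fun ω => ∫ y in Icc (0 : State d) 1, ind K (X i ω) y ∂μ :=
    fun i K hK => ((hind i K hK).stronglyMeasurable.integral_prod_right
      (ν := μ.restrict (Icc 0 1))).measurable
  have hnum : ∀ i, ∀ K ∈ m, Measurable fun ω => ind K (X i ω) (X (i + 1) ω) := fun i K hK =>
    (measurable_ind (hm.measurableSet hK)).comp
      ((hX.measurable_chain i).prodMk (hX.measurable_chain (i + 1)))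
  have hest : ∀ i, Measurable fun p : Ω × State d =>
      pieceEst μ n (fun i => X i p.1) m (X i p.1) p.2 := fun i => by
    refine Finset.measurable_fun_sum _ fun K hK => Measurable.mul ?_ (hind i K hK)
    exact ((Finset.measurable_fun_sum _ fun k _ => hnum k K hK).div
      (Finset.measurable_fun_sum _ fun k _ => hden k K hK)).comp measurable_fst
  have hdens : ∀ i, Measurable fun p : Ω × State d => restr s (Icc 0 1) (X i p.1) p.2 :=
    fun i => by
      have h : Measurable fun p : Ω × State d => (X i p.1, p.2) :=
        ((hX.measurable_chain i).comp measurable_fst).prodMk measurable_snd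
      exact (hX.measurable_density.comp h).mul ((measurable_ind measurableSet_Icc).comp h)
  have hzero : ∀ i ω, ∀ y ∉ Icc (0 : State d) 1, (√(restr s (Icc 0 1) (X i ω) y) -
      √(pieceEst μ n (fun i => X i ω) m (X i ω) y)) ^ 2 = 0 := by
    intro i ω y hy
    rw [pieceEst_eq hμ n _ hm, restr, ind_eq_zero_of_notMem subset_rfl hy,
      Finset.sum_eq_zero fun K hK => by
        rw [ind_eq_zero_of_notMem (hm.subset_Icc hK) hy, mul_zero]]
    simp
  unfold hellSq
  refine (Finset.measurable_fun_sum _ fun i _ => ?_).const_mul _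
  have hmeas := ((((hdens i).sqrt.sub (hest i).sqrt).pow_const
    2).stronglyMeasurable.integral_prod_right (f := fun ω y => (√(restr s (Icc 0 1) (X i ω) y) -
      √(pieceEst μ n (fun i => X i ω) m (X i ω) y)) ^ 2) (ν := μ.restrict (Icc 0 1))).measurable
  convert! hmeas using 2 with ω
  exact (setIntegral_eq_integral_of_forall_compl_eq_zero (hzero i ω)).symm

/-- The event is split according to the countably many values of `mhat`. -/
lemma measurable_loss (hd : 1 ≤ d) (hμ : μ (Icc 0 1) = 1) (n : ℕ)
    {mhat : Ω → Finset (Set (Pt d))} (hmeas : ∀ m, MeasurableSet {ω | mhat ω = m})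
    (hmem : ∀ ω, mhat ω ∈ allPartitions d) :
    Measurable fun ω => hellSq μ n (fun i => X i ω) (restr s (Icc 0 1))
      (pieceEst μ n (fun i => X i ω) (mhat ω)) := by
  intro B hB
  have h : (fun ω => hellSq μ n (fun i => X i ω) (restr s (Icc 0 1))
      (pieceEst μ n (fun i => X i ω) (mhat ω))) ⁻¹' B =
      ⋃ m ∈ allPartitions d, {ω | mhat ω = m} ∩ (fun ω => hellSq μ n (fun i => X i ω)
        (restr s (Icc 0 1)) (pieceEst μ n (fun i => X i ω) m)) ⁻¹' B := by
    ext ω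
    simp only [mem_preimage, mem_iUnion, mem_inter_iff, mem_ofPred_eq, exists_prop]
    constructor
    · exact fun h => ⟨mhat ω, hmem ω, rfl, h⟩
    · rintro ⟨m, -, rfl, h⟩; exact h
  rw [h]
  exact MeasurableSet.biUnion (countable_allPartitions hd) fun m hm =>
    (hmeas m).inter (hX.measurable_hellSq_pieceEst hμ n (isDyadicPartition_of_mem hd hm) hB)

lemma integrable_loss [IsProbabilityMeasure P] (hd : 1 ≤ d) (hμ : μ (Icc 0 1) = 1) {n : ℕ}
    (hn : 0 < n) {mhat : Ω → Finset (Set (Pt d))} (hmeas : ∀ m, MeasurableSet {ω | mhat ω = m})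
    (hmem : ∀ ω, mhat ω ∈ allPartitions d) :
    Integrable (fun ω => hellSq μ n (fun i => X i ω) (restr s (Icc 0 1))
      (pieceEst μ n (fun i => X i ω) (mhat ω))) P := by
  refine Integrable.of_bound (hX.measurable_loss hd hμ n hmeas hmem).aestronglyMeasurable 1
    (Filter.Eventually.of_forall fun ω => ?_)
  rw [Real.norm_of_nonneg]
  · exact hX.hellSq_pieceEst_le_one hμ hn _ (isDyadicPartition_of_mem hd (hmem ω))
  · rw [hX.hellSq_pieceEst hμ n _ (isDyadicPartition_of_mem hd (hmem ω))]
    exact mul_nonneg (by positivity) (Finset.sum_nonneg fun K _ => cellLoss_nonneg _ _ _ _)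

/-- The risk bound, with an explicit constant. -/
lemma risk_le [IsProbabilityMeasure P] (hd : 1 ≤ d) (hμ : μ (Icc 0 1) = 1) {n : ℕ} (hn : 3 < n)
    {L : ℝ} (hL : 800 ≤ L) {σ R : ℝ} (hσ : 0 < σ) (hσ1 : σ ≤ 1) (hR : 0 ≤ R)
    (hH : HolderOnCube σ R fun z : Pt d => √(s (z ∘ Sum.inl) (z ∘ Sum.inr)))
    {mhat : Ω → Finset (Set (Pt d))} (hmeas : ∀ m, MeasurableSet {ω | mhat ω = m})
    (hsel : ∀ ω, IsSelected μ n L (allPartitions d) (fun i => X i ω) (mhat ω)) :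
    ∫ ω, hellSq μ n (fun i => X i ω) (restr s (Icc 0 1))
      (pieceEst μ n (fun i => X i ω) (mhat ω)) ∂P ≤
      (4409 + 32 * L) * (((d : ℝ) * R) ^ (2 * d / (d + σ)) * (Real.log n / n) ^ (σ / (σ + d))
        + Real.log n / n) := by
  have hn0 : (0 : ℝ) < n := by positivity
  have hlog := one_le_log hn
  have hint := hX.integrable_loss hd hμ (by omega : 0 < n) hmeas fun ω => (hsel ω).1
  have hone : ∀ ω, hellSq μ n (fun i => X i ω) (restr s (Icc 0 1))
      (pieceEst μ n (fun i => X i ω) (mhat ω)) ≤ 1 := fun ω =>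
    hX.hellSq_pieceEst_le_one hμ (by omega) _ (isDyadicPartition_of_mem hd (hsel ω).1)
  set ρ := Real.log n / n with hρ
  have hρ0 : 0 < ρ := div_pos (by linarith) hn0
  have hnρ : 1 / (n : ℝ) ≤ ρ := by rw [hρ]; gcongr
  set D := ((d : ℝ) * R) ^ (2 * d / (d + σ)) * ρ ^ (σ / (σ + d)) + ρ with hD
  have hρD : ρ ≤ D := le_add_of_nonneg_left (by positivity)
  -- If `D ≥ 1`, the bound of the loss by one suffices. Otherwise `4 ^ (d * j) / n ≤ D < 1`, which
  -- forces `j ≤ n` as the oracle inequality requires.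
  rcases le_or_gt 1 D with hD1 | hD1
  · calc _ ≤ ∫ _ω, (1 : ℝ) ∂P := integral_mono hint (integrable_const _) hone
      _ = 1 := by simp
      _ ≤ _ := by nlinarith
  obtain ⟨j, hj1, hj2⟩ := exists_level hd hσ hσ1 (by positivity : 0 ≤ (d : ℝ) * R) hρ0
  rw [← hD] at hj1 hj2
  have hjn : j ≤ n := by
    have h1 : (4 : ℝ) ^ (d * j) * ρ < 1 := hj2.trans_lt hD1
    have h2 : (4 : ℝ) ^ (d * j) < n := by
      have := (mul_le_mul_of_nonneg_left hnρ (show (0 : ℝ) ≤ 4 ^ (d * j) by positivity)).trans_lt h1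
      rwa [mul_one_div, div_lt_one hn0] at this
    have h3 : 4 ^ (d * j) < n := by exact_mod_cast h2
    have h4 : d * j < 4 ^ (d * j) := Nat.lt_pow_self (by norm_num)
    have h5 : j ≤ d * j := Nat.le_mul_of_pos_left j hd
    omega
  obtain ⟨G, hGm, hGP, hG⟩ := hX.exists_concentrated hd hμ hn
  have hcard : ((regular d j).card : ℝ) * ρ ≤ D := by
    refine le_trans ?_ hj2
    have : ((regular d j).card : ℝ) ≤ 4 ^ (d * j) := by exact_mod_cast card_regular_le d j
    gcongr
  have hgood : ∀ ω ∈ G, hellSq μ n (fun i => X i ω) (restr s (Icc 0 1))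
      (pieceEst μ n (fun i => X i ω) (mhat ω)) ≤ (4408 + 32 * L) * D := by
    intro ω hω
    have h1 := hX.hellSq_selected_le hd hμ hn (hG ω hω) hL (hsel ω) hjn
    have h2 := hX.hellSq_regular_le hd hμ hn (hG ω hω) hjn
      (δ := 2 * (d * R) * (1 / 2 ^ j) ^ σ) fun K hK z hz w hw => by
        obtain ⟨v, -, rfl⟩ := mem_regular.1 hK
        exact HolderOnCube.abs_sub_le_of_mem_cell hσ hR hH hz hw
    have h3 : (2 * (d * R) * (1 / 2 ^ j : ℝ) ^ σ) ^ 2 =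
        4 * ((d * R) ^ 2 * ((1 / 2 ^ j : ℝ) ^ σ) ^ 2) := by ring
    have h4 : pen L n (regular d j) ≤ L * D := by
      have : pen L n (regular d j) = L * ((regular d j).card * ρ) := by
        rw [pen, hρ]; ring
      rw [this]
      exact mul_le_mul_of_nonneg_left hcard (by linarith)
    rw [h3] at h2
    -- The squared oscillation is at most `16 D`, so the constant is `50 * (16 + 72) + 32 L + 8`.
    -- The bad event later adds `1/n ≤ D`.
    linarith
  have hc0 : 0 ≤ (4408 + 32 * L) * D := mul_nonneg (by linarith) (hρ0.le.trans hρD)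
  calc _ ≤ ∫ ω, ((4408 + 32 * L) * D + Gᶜ.indicator (fun _ => 1) ω) ∂P := by
        refine integral_mono hint ((integrable_const _).add
          ((integrable_const 1).indicator hGm.compl)) fun ω => ?_
        by_cases hω : ω ∈ G
        · have : ω ∉ Gᶜ := fun h => h hω
          simp only [Set.indicator_of_notMem this, add_zero]
          exact hgood ω hω
        · have : ω ∈ Gᶜ := hω
          simp only [Set.indicator_of_mem this]
          linarith [hone ω]
    _ = (4408 + 32 * L) * D + P.real Gᶜ := by
        rw [integral_add (integrable_const _) ((integrable_const 1).indicator hGm.compl),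
          integral_indicator hGm.compl]
        simp
    _ ≤ _ := by linarith

end IsMarkovChainWithDensity

end

end TransitionDensity

end

open TransitionDensity in
theorem mainTheorem6 :
    ∃ L₀ : ℝ, 0 < L₀ ∧ ∀ L : ℝ, L₀ ≤ L → ∃ C : ℝ, 0 < C ∧
      ∀ (d n : ℕ), 1 ≤ d → 3 < n →
      ∀ (μ : Measure (State d)), μ (Icc 0 1) = 1 →
      ∀ (Ω : Type*) [MeasurableSpace Ω] (P : Measure Ω) [IsProbabilityMeasure P]
        (X : ℕ → Ω → State d) (s : State d → State d → ℝ),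
        IsMarkovChainWithDensity P μ s X →
      ∀ (σ R : ℝ), 0 < σ → σ ≤ 1 → 0 ≤ R →
        HolderOnCube σ R (fun z : Pt d => √(s (z ∘ Sum.inl) (z ∘ Sum.inr))) →
      ∀ (mhat : Ω → Finset (Set (Pt d))),
        (∀ m, MeasurableSet {ω | mhat ω = m}) →
        (∀ ω, IsSelected μ n L (allPartitions d) (fun i => X i ω) (mhat ω)) →
        let loss : Ω → ℝ := fun ω =>
          hellSq μ n (fun i => X i ω) (restr s (Icc 0 1))
            (pieceEst μ n (fun i => X i ω) (mhat ω))
        Integrable loss P ∧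
        C * ∫ ω, loss ω ∂P ≤
          ((d : ℝ) * R) ^ (2 * d / (d + σ)) * (Real.log n / n) ^ (σ / (σ + d))
            + Real.log n / n := by
  -- `800 = 100 * 8`: each cell of an overlay costs `100 u` with `u = 8 log n`.
  refine ⟨800, by norm_num, fun L hL => ⟨(4409 + 32 * L)⁻¹, inv_pos.2 (by linarith), ?_⟩⟩
  intro d n hd hn μ hμ Ω _ P _ X s hX σ R hσ hσ1 hR hH mhat hmeas hsel loss
  refine ⟨hX.integrable_loss hd hμ (by omega) hmeas fun ω => (hsel ω).1, ?_⟩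
  rw [inv_mul_le_iff₀ (by linarith)]
  exact hX.risk_le hd hμ hn hL hσ hσ1 hR hH hmeas hsel
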